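/- Let $H, D$ be Lie groups (modelled on real normed spaces, e.g. finite dimensional) and let $(H\xrightarrow{\alpha} D)$ be a crossed module: $\alpha$ is a smooth homomorphism and $D$ acts smoothly on $H$ by automorphisms $h\mapsto {}^dh$, with ${}^{\alpha(h)}h'=hh'h^{-1}$ and $\alpha({}^dh)=d\,\alpha(h)\,d^{-1}$. Let $X$ be a smooth manifold with an open cover $\{O_i\}_{i\in I}$. Write $O_{i_0\dots i_n}=O_{i_0}\cap\dots\cap O_{i_n}$, let $X_n=\bigsqcup_{(i_0,\dots,i_n)}O_{i_0\dots i_n}$ be the Čech nerve, and use $\partial_i, s_i$ for all face and degeneracy maps. **The simplicial group.** Let $G=N\mathcal C_{(H\to D)}$ be the nerve of the category with objects $d\in D$ and arrows $h:d\to\alpha(h)d$. Thus $G_n$ consists of the chains $d_n\to d_{n-1}\to\dots\to d_0$, $\partial_i$ omits and $s_i$ repeats $d_i$, $G_n\cong D\times H^n$ as a manifold, and the product is horizontal composition, $(h,d)(h',d')=(h\,{}^{d}h',dd')$ on arrows with sources $d,d'$. Let $\bar G_n=\ker(\partial_1\cdots\partial_n:G_n\to G_0)$ be the group of chains with $d_0=1$.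 The group $G_n$ acts on $\bar G_{n+1}$ by ${}^gx=s_0(g)\,x\,s_0(g)^{-1}$. **Bundles.** A simplicial principal $G$-bundle over the Čech nerve (with pseudo-cross section) is given by a smooth twisting function $\tau:X_{n+1}\to G_n$, $n\ge 0$: $$\partial_0\tau(x)=\tau(\partial_1x)\,\tau(\partial_0x)^{-1},\qquad \partial_i\tau(x)=\tau(\partial_{i+1}x)\ (i>0),\qquad s_i\tau(x)=\tau(s_{i+1}x)\ (i\ge0),\qquad \tau(s_0x)=1 .$$ **$\bar B$-fields.** A simplicial $\bar B$-field on it is a collection of smooth 2-forms $\bar B_{n+1}\in\Omega^2(X_n)\otimes\mathrm{Lie}(\bar G_{n+1})$, $n\ge0$, with $${}^{\tau}\partial_0^*\bar B=\partial_1\bar B,\qquad \partial_i^*\bar B=\partial_{i+1}\bar B\ (i>0),\qquad s_i^*\bar B=s_{i+1}\bar B\ (i\ge0).$$ **The gerbe.** Put $d_{ij}=\tau|_{O_{ij}}:O_{ij}\to D$, and let $h_{ijk}:O_{ijk}\to H$ be the arrow of $\tau|_{O_{ijk}}=(d_{ik}d_{jk}^{-1}\xrightarrow{h_{ijk}}d_{ij})$.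 **Proposition.** (1) $\{d_{ij},h_{ijk}\}$ is a smooth crossed module bundle gerbe cocycle: $d_{ij}d_{jk}=\alpha(h_{ijk})d_{ik}$ on $O_{ijk}$, and $h_{ijk}h_{ikl}={}^{d_{ij}}h_{jkl}\,h_{ijl}$ on $O_{ijkl}$. (2) Call a *$B$-field* on this bundle gerbe a collection of smooth 2-forms $B_i\in\Omega^2(O_i)\otimes\mathrm{Lie}(H)$, $\delta_{ij}\in\Omega^2(O_{ij})\otimes\mathrm{Lie}(H)$ with $$B_i={}^{d_{ij}}B_j+\delta_{ij}\ \text{ on } O_{ij},\qquad \delta_{ij}+{}^{d_{ij}}\delta_{jk}=h_{ijk}\delta_{ik}h_{ijk}^{-1}+B_i-h_{ijk}B_ih_{ijk}^{-1}\ \text{ on } O_{ijk}.$$ Identify $\mathrm{Lie}(\bar G_1)$ with $\mathrm{Lie}(H)$ by sending a chain to minus its arrow. Then for every simplicial $\bar B$-field the forms $$B_i=\bar B_1|_{O_i},\qquad \delta_{ij}=(\partial_2\bar B_2-\partial_1\bar B_2)|_{O_{ij}}$$ are a $B$-field on the bundle gerbe. Conversely, every $B$-field on the bundle gerbe arises in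 this way from exactly one simplicial $\bar B$-field. -/

import Mathlib

open Set TopologicalSpace
open scoped Manifold ContDiff

noncomputable section

namespace CrossedGerbe

/-! ### Crossed modules of Lie groups -/

/-- A crossed module `α : H → D` of Lie groups (modelled on `EH` and `ED`), with smooth action of
`D` on `H` by automorphisms. -/
structure CrossedModule
    {EH : Type*} [NormedAddCommGroup EH] [NormedSpace ℝ EH]
    {ED : Type*} [NormedAddCommGroup ED] [NormedSpace ℝ ED]
    (H : Type*) [TopologicalSpace H] [ChartedSpace EH H] [Group H]
    (D : Type*) [TopologicalSpace D] [ChartedSpace ED D] [Group D] where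
  α : H →* D
  act : D →* MulAut H
  smooth_α : ContMDiff 𝓘(ℝ, EH) 𝓘(ℝ, ED) ∞ α
  smooth_act : ContMDiff (𝓘(ℝ, ED).prod 𝓘(ℝ, EH)) 𝓘(ℝ, EH) ∞ (fun p : D × H => act p.1 p.2)
  peiffer : ∀ h h' : H, act (α h) h' = h * h' * h⁻¹
  equivariant : ∀ (d : D) (h : H), α (act d h) = d * α h * d⁻¹

section Nerve

variable {EH : Type*} [NormedAddCommGroup EH] [NormedSpace ℝ EH]
  {ED : Type*} [NormedAddCommGroup ED] [NormedSpace ℝ ED]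
  {H : Type*} [TopologicalSpace H] [ChartedSpace EH H] [Group H]
  {D : Type*} [TopologicalSpace D] [ChartedSpace ED D] [Group D]

/-- The derivative at `1` of the automorphism `h ↦ ᵈh`: the action of `d ∈ D` on `Lie(H)`.
(The tangent space of `H` at `1` is, by definition in Mathlib, the model space `EH`.) -/
def CrossedModule.lieAct (𝒳 : CrossedModule (EH := EH) (ED := ED) H D) (d : D) : EH →L[ℝ] EH :=
  mfderiv 𝓘(ℝ, EH) 𝓘(ℝ, EH) (fun h : H => 𝒳.act d h) 1

/-- The adjoint action `Y ↦ h Y h⁻¹` of `h ∈ H` on `Lie(H)`. -/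
def lieConj (h : H) : EH →L[ℝ] EH :=
  mfderiv 𝓘(ℝ, EH) 𝓘(ℝ, EH) (fun x : H => h * x * h⁻¹) 1

/-! ### The simplicial Lie group `N C_(H → D)`

The category `C_(H → D)` has the elements of `D` as objects, and an arrow `h : d → α(h) d` for
all `h ∈ H`, `d ∈ D`; arrows are composed by multiplication in `H`. An `n`-simplex of the nerve is
a chain `d_n → d_{n-1} → ⋯ → d_0` of composable arrows. As a manifold it is `D × Hⁿ`: we record the
source `d_n` and, for `i < n`, the (composite) arrow `d_n → d_i`. All other arrows of the chain are
recovered by `arrow` below; in particular the consecutive ones `h_{i,i+1} = arrow g i (i+1)`. -/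

/-- The manifold `D × Hⁿ` of `n`-simplices of the nerve of `C_(H → D)`. -/
def Nerve (_𝒳 : CrossedModule (EH := EH) (ED := ED) H D) (n : ℕ) : Type _ := D × (Fin n → H)

/-- The Lie algebra of `Nerve 𝒳 n`, i.e. the tangent space at `1`, which by definition is the model
vector space of the manifold `D × Hⁿ`. -/
abbrev LieNerve (_𝒳 : CrossedModule (EH := EH) (ED := ED) H D) (n : ℕ) : Type _ :=
  ED × (Fin n → EH)

/-- The model with corners (without boundary) of the product manifold `D × Hⁿ`. -/
abbrev nerveModel (_𝒳 : CrossedModule (EH := EH) (ED := ED) H D) (n : ℕ) :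
    ModelWithCorners ℝ (ED × (Fin n → EH)) (ModelProd ED (ModelPi fun _ : Fin n => EH)) :=
  𝓘(ℝ, ED).prod (ModelWithCorners.pi fun _ : Fin n => 𝓘(ℝ, EH))

namespace Nerve

variable {𝒳 : CrossedModule (EH := EH) (ED := ED) H D} {m n : ℕ}

instance : TopologicalSpace (Nerve 𝒳 n) := inferInstanceAs (TopologicalSpace (D × (Fin n → H)))

instance : ChartedSpace (ModelProd ED (ModelPi fun _ : Fin n => EH)) (Nerve 𝒳 n) :=
  inferInstanceAs (ChartedSpace (ModelProd ED (ModelPi fun _ : Fin n => EH)) (D × (Fin n → H)))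

/-- The composite arrow `d_n → d_i` of the chain (the identity for `i = n`). -/
def fromTop (g : Nerve 𝒳 n) (i : Fin (n + 1)) : H := Fin.snoc (α := fun _ => H) g.2 1 i

/-- The object `d_i` of the chain. -/
def vertex (g : Nerve 𝒳 n) (i : Fin (n + 1)) : D := 𝒳.α (g.fromTop i) * g.1

/-- The arrow `d_j → d_i` of the chain. -/
def arrow (g : Nerve 𝒳 n) (i j : Fin (n + 1)) : H := g.fromTop i * (g.fromTop j)⁻¹

/-- Horizontal composition: `(h, d) (h', d') = (h · ᵈh', d d')` on arrows with source `d`, `d'`. -/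
instance : Mul (Nerve 𝒳 n) := ⟨fun g g' => (g.1 * g'.1, fun i => g.2 i * 𝒳.act g.1 (g'.2 i))⟩

instance : One (Nerve 𝒳 n) := ⟨((1 : D), fun _ => (1 : H))⟩

instance : Inv (Nerve 𝒳 n) := ⟨fun g => (g.1⁻¹, fun i => 𝒳.act g.1⁻¹ (g.2 i)⁻¹)⟩

instance : Group (Nerve 𝒳 n) :=
  Group.ofLeftAxioms
    (fun a b c => Prod.ext (mul_assoc a.1 b.1 c.1) (funext fun i => by
      change a.2 i * 𝒳.act a.1 (b.2 i) * 𝒳.act (a.1 * b.1) (c.2 i)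
        = a.2 i * 𝒳.act a.1 (b.2 i * 𝒳.act b.1 (c.2 i))
      simp [mul_assoc]))
    (fun a => Prod.ext (one_mul a.1) (funext fun i => by
      change 1 * 𝒳.act 1 (a.2 i) = a.2 i
      simp))
    (fun a => Prod.ext (inv_mul_cancel a.1) (funext fun i => by
      change 𝒳.act a.1⁻¹ (a.2 i)⁻¹ * 𝒳.act a.1⁻¹ (a.2 i) = 1
      simp))

/-- The simplicial operator of a map `f : [m] → [n]`: the chain with objects `d_{f 0}, …, d_{f m}`
and with arrows those of the given chain. -/
def map (f : Fin (m + 1) → Fin (n + 1)) (g : Nerve 𝒳 n) : Nerve 𝒳 m :=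
  (g.vertex (f (Fin.last m)), fun i => g.arrow (f i.castSucc) (f (Fin.last m)))

/-- The face map `∂_i` (omit the object `d_i`). -/
def face (i : Fin (n + 2)) : Nerve 𝒳 (n + 1) → Nerve 𝒳 n := map i.succAbove

/-- The degeneracy map `s_i` (repeat the object `d_i`). -/
def degen (i : Fin (n + 1)) : Nerve 𝒳 n → Nerve 𝒳 (n + 1) := map i.predAbove

/-- The composite face map `∂_1 ∂_2 ⋯ ∂_n : G_n → G_0`. -/
def bottom : ∀ n : ℕ, Nerve 𝒳 n → Nerve 𝒳 0
  | 0 => id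
  | n + 1 => fun g => bottom n (face (Fin.last (n + 1)) g)

/-- The action `ᵍx = s_0(g) x s_0(g)⁻¹` of `G_n` on `G_{n+1}`. It preserves the kernel `Ḡ_{n+1}` of
`∂_1 ⋯ ∂_{n+1}`; it satisfies `∂_0 (ᵍx) = g ∂_0(x) g⁻¹`, and for `x, y ∈ Ḡ_{n+1}` the element
`∂_0 x` acts on `y` by `x y x⁻¹`. For `n = 0` it is the action of `D` on `Ḡ_1 ≅ H`. -/
def barAct (g : Nerve 𝒳 n) (x : Nerve 𝒳 (n + 1)) : Nerve 𝒳 (n + 1) :=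
  degen 0 g * x * (degen 0 g)⁻¹

/-- The derivative at `1` of a map `f : G_m → G_n` (used for maps with `f 1 = 1`). -/
def lieMap (f : Nerve 𝒳 m → Nerve 𝒳 n) : LieNerve 𝒳 m →L[ℝ] LieNerve 𝒳 n :=
  mfderiv (nerveModel 𝒳 m) (nerveModel 𝒳 n) f 1

/-- The derivative at `1` of the map sending a `1`-simplex `d_1 → d_0` to its arrow in `H`. -/
def lieArrow : LieNerve 𝒳 1 →L[ℝ] EH :=
  mfderiv (nerveModel 𝒳 1) 𝓘(ℝ, EH) (fun g : Nerve 𝒳 1 => g.arrow 0 1) 1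

/-- The Lie algebra of `Ḡ_n = ker (∂_1 ⋯ ∂_n) ⊂ G_n`. -/
def lieBar (𝒳 : CrossedModule (EH := EH) (ED := ED) H D) (n : ℕ) :
    Submodule ℝ (LieNerve 𝒳 n) :=
  (lieMap (bottom (𝒳 := 𝒳) n)).ker

/-! The following facts record that the data above form the nerve with its group structure. -/

theorem ext_arrow {g g' : Nerve 𝒳 n} (h1 : g.vertex (Fin.last n) = g'.vertex (Fin.last n))
    (h2 : ∀ i, g.arrow i (Fin.last n) = g'.arrow i (Fin.last n)) : g = g' := by
  refine Prod.ext ?_ (funext fun i => ?_)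
  · simpa [vertex, fromTop] using h1
  · simpa [arrow, fromTop] using h2 i.castSucc

theorem arrow_target (g : Nerve 𝒳 n) (i j : Fin (n + 1)) :
    𝒳.α (g.arrow i j) * g.vertex j = g.vertex i := by
  simp [arrow, vertex, ← mul_assoc]

theorem arrow_comp (g : Nerve 𝒳 n) (i j k : Fin (n + 1)) :
    g.arrow i j * g.arrow j k = g.arrow i k := by
  simp [arrow, mul_assoc]

theorem fromTop_mul (g g' : Nerve 𝒳 n) (i : Fin (n + 1)) :
    (g * g').fromTop i = g.fromTop i * 𝒳.act g.1 (g'.fromTop i) := by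
  refine Fin.lastCases ?_ (fun i => ?_) i
  · simp [fromTop]
  · simp only [fromTop, Fin.snoc_castSucc]; rfl

theorem vertex_mul (g g' : Nerve 𝒳 n) (i : Fin (n + 1)) :
    (g * g').vertex i = g.vertex i * g'.vertex i := by
  have h1 : (g * g').1 = g.1 * g'.1 := rfl
  simp [vertex, fromTop_mul, 𝒳.equivariant, h1, mul_assoc]

theorem arrow_mul (g g' : Nerve 𝒳 n) (i j : Fin (n + 1)) :
    (g * g').arrow i j = g.arrow i j * 𝒳.act (g.vertex j) (g'.arrow i j) := by
  simp [arrow, vertex, fromTop_mul, 𝒳.peiffer, mul_assoc]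

theorem vertex_map (f : Fin (m + 1) → Fin (n + 1)) (g : Nerve 𝒳 n) (i : Fin (m + 1)) :
    (map f g).vertex i = g.vertex (f i) := by
  refine Fin.lastCases ?_ (fun i => ?_) i
  · simp [map, vertex, fromTop]
  · rw [← arrow_target g (f i.castSucc) (f (Fin.last m))]
    simp [map, vertex, fromTop]

theorem arrow_map (f : Fin (m + 1) → Fin (n + 1)) (g : Nerve 𝒳 n) (i j : Fin (m + 1)) :
    (map f g).arrow i j = g.arrow (f i) (f j) := by
  have h : ∀ i, (map f g).fromTop i = g.arrow (f i) (f (Fin.last m)) := fun i => by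
    refine Fin.lastCases ?_ (fun i => ?_) i
    · simp [map, fromTop, arrow]
    · simp [map, fromTop]
  rw [arrow, h, h]
  simp [arrow]

end Nerve

end Nerve

/-! ### The Čech nerve, simplicial bundles and differential forms -/

section Cech

variable {EH : Type*} [NormedAddCommGroup EH] [NormedSpace ℝ EH]
  {ED : Type*} [NormedAddCommGroup ED] [NormedSpace ℝ ED]
  {EX : Type*} [NormedAddCommGroup EX] [NormedSpace ℝ EX]
  {H : Type*} [TopologicalSpace H] [ChartedSpace EH H] [Group H]
  {D : Type*} [TopologicalSpace D] [ChartedSpace ED D] [Group D]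
  {X : Type*} [TopologicalSpace X] [ChartedSpace EX X] {ι : Type*}

/-- `O_{a_0} ∩ ⋯ ∩ O_{a_n}`. The manifold of `n`-simplices of the Čech nerve is the disjoint union
of these open sets over all `a : Fin (n + 1) → ι`; its `i`-th face (degeneracy) map sends the point
`x` of the component of `a` to the point `x` of the component of `a ∘ i.succAbove`
(`a ∘ i.predAbove`). -/
def cechOpen (O : ι → Opens X) {n : ℕ} (a : Fin (n + 1) → ι) : Opens X :=
  ⟨{x | ∀ k, x ∈ O (a k)}, by
    simpa [Set.ofPred_forall] using isOpen_iInter_of_finite fun k => (O (a k)).isOpen⟩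

/-- The simplicial operator of the Čech nerve defined by `f : [m] → [n]`. -/
def cechMap (O : ι → Opens X) {m n : ℕ} (f : Fin (m + 1) → Fin (n + 1)) {a : Fin (n + 1) → ι}
    (x : cechOpen O a) : cechOpen O (a ∘ f) := ⟨x.1, fun k => x.2 (f k)⟩

theorem mem_cechOpen_pair {O : ι → Opens X} {i j : ι} {x : X} (hi : x ∈ O i) (hj : x ∈ O j) :
    x ∈ cechOpen O ![i, j] := fun k => by fin_cases k <;> assumption

theorem mem_cechOpen_triple {O : ι → Opens X} {i j k : ι} {x : X} (hi : x ∈ O i) (hj : x ∈ O j)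
    (hk : x ∈ O k) : x ∈ cechOpen O ![i, j, k] := fun l => by fin_cases l <;> assumption

/-- A (smooth) simplicial principal bundle over the Čech nerve of `O` with structure group
`G = Nerve 𝒳`, given as a twisted Cartesian product `G ×_τ X` with
`∂_0 (g, x) = (∂_0 g · τ(x), ∂_0 x)`, that is by a smooth twisting function `τ : X_{n+1} → G_n`. -/
structure SimplicialBundle (𝒳 : CrossedModule (EH := EH) (ED := ED) H D) (O : ι → Opens X) where
  τ : ∀ (n : ℕ) (a : Fin (n + 2) → ι), cechOpen O a → Nerve 𝒳 n
  smooth : ∀ n a, ContMDiff 𝓘(ℝ, EX) (nerveModel 𝒳 n) ∞ (τ n a)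
  face_zero : ∀ (n : ℕ) (a : Fin (n + 3) → ι) (x : cechOpen O a),
    Nerve.face 0 (τ (n + 1) a x) =
      τ n (a ∘ Fin.succAbove 1) (cechMap O (Fin.succAbove 1) x) *
        (τ n (a ∘ Fin.succAbove 0) (cechMap O (Fin.succAbove 0) x))⁻¹
  face_succ : ∀ (n : ℕ) (a : Fin (n + 3) → ι) (x : cechOpen O a) (i : Fin (n + 1)),
    Nerve.face i.succ (τ (n + 1) a x) =
      τ n (a ∘ i.succ.succ.succAbove) (cechMap O i.succ.succ.succAbove x)
  degen_succ : ∀ (n : ℕ) (a : Fin (n + 2) → ι) (x : cechOpen O a) (i : Fin (n + 1)),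
    Nerve.degen i (τ n a x) = τ (n + 1) (a ∘ i.succ.predAbove) (cechMap O i.succ.predAbove x)
  degen_zero : ∀ (n : ℕ) (a : Fin (n + 1) → ι) (x : cechOpen O a),
    τ n (a ∘ Fin.predAbove 0) (cechMap O (Fin.predAbove 0) x) = 1

open Classical in
/-- The coordinate expression in the chart at `x₀` of a field `w` of `V`-valued alternating bilinear
forms on the tangent spaces of `U`: its pullback under the chart parametrization `φ.symm`. -/
def coordForm {U : Opens X} {V : Type*} [NormedAddCommGroup V] [NormedSpace ℝ V]
    (w : ∀ x : U, TangentSpace 𝓘(ℝ, EX) (x : X) [⋀^Fin 2]→L[ℝ] V) (x₀ : X) (y : EX) :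
    EX [⋀^Fin 2]→L[ℝ] V :=
  if h : (chartAt EX x₀).symm y ∈ U then
    (w ⟨(chartAt EX x₀).symm y, h⟩).compContinuousLinearMap
      (mfderiv 𝓘(ℝ, EX) 𝓘(ℝ, EX) (chartAt EX x₀).symm y)
  else 0

/-- A smooth differential `2`-form on the open subset `U` of the manifold `X` with values in the
normed space `V`: an alternating bilinear form on each tangent space, with smooth coordinate
expression in each chart. -/
structure TwoForm (U : Opens X) (V : Type*) [NormedAddCommGroup V] [NormedSpace ℝ V] where
  toFun : ∀ x : U, TangentSpace 𝓘(ℝ, EX) (x : X) [⋀^Fin 2]→L[ℝ] V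
  smooth : ∀ x₀ : X, ContDiffOn ℝ ∞ (coordForm toFun x₀)
    {y | y ∈ (chartAt EX x₀).target ∧ (chartAt EX x₀).symm y ∈ U}

instance (U : Opens X) (V : Type*) [NormedAddCommGroup V] [NormedSpace ℝ V] :
    CoeFun (TwoForm (EX := EX) U V)
      (fun _ => ∀ x : U, TangentSpace 𝓘(ℝ, EX) (x : X) [⋀^Fin 2]→L[ℝ] V) :=
  ⟨TwoForm.toFun⟩

variable {𝒳 : CrossedModule (EH := EH) (ED := ED) H D} {O : ι → Opens X}

/-- A simplicial `B̄`-field: `2`-forms `B̄_{n+1}` on the manifolds `X_n` of the Čech nerve with values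
in `Lie(Ḡ_{n+1})`, such that `^τ ∂_0^* B̄ = ∂_1 B̄`, `∂_i^* B̄ = ∂_{i+1} B̄` for `i > 0` and
`s_i^* B̄ = s_{i+1} B̄` for `i ≥ 0`. -/
structure BBarField (P : SimplicialBundle (EX := EX) 𝒳 O) where
  form : ∀ (n : ℕ) (a : Fin (n + 1) → ι), TwoForm (EX := EX) (cechOpen O a) (LieNerve 𝒳 (n + 1))
  mem_lieBar : ∀ (n : ℕ) (a : Fin (n + 1) → ι) (x : cechOpen O a)
    (v : Fin 2 → TangentSpace 𝓘(ℝ, EX) (x : X)), form n a x v ∈ Nerve.lieBar 𝒳 (n + 1)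
  face_zero : ∀ (n : ℕ) (a : Fin (n + 2) → ι) (x : cechOpen O a),
    (Nerve.lieMap (Nerve.barAct (P.τ n a x))).compContinuousAlternatingMap
        (form n (a ∘ Fin.succAbove 0) (cechMap O (Fin.succAbove 0) x)) =
      (Nerve.lieMap (Nerve.face (𝒳 := 𝒳) 1)).compContinuousAlternatingMap (form (n + 1) a x)
  face_succ : ∀ (n : ℕ) (a : Fin (n + 2) → ι) (x : cechOpen O a) (i : Fin (n + 2)), 0 < i →
    form n (a ∘ i.succAbove) (cechMap O i.succAbove x) =
      (Nerve.lieMap (Nerve.face (𝒳 := 𝒳) i.succ)).compContinuousAlternatingMap (form (n + 1) a x)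
  degen : ∀ (n : ℕ) (a : Fin (n + 1) → ι) (x : cechOpen O a) (i : Fin (n + 1)),
    form (n + 1) (a ∘ i.predAbove) (cechMap O i.predAbove x) =
      (Nerve.lieMap (Nerve.degen (𝒳 := 𝒳) i.succ)).compContinuousAlternatingMap (form n a x)

/-! ### Crossed module bundle gerbes -/

/-- A smooth nonabelian cocycle `{d_ij, h_ijk}`, describing a crossed module bundle gerbe. -/
structure IsGerbeCocycle (𝒳 : CrossedModule (EH := EH) (ED := ED) H D) (O : ι → Opens X)
    (d : ∀ i j, (O i ⊓ O j : Opens X) → D) (h : ∀ i j k, (O i ⊓ O j ⊓ O k : Opens X) → H) :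
    Prop where
  smooth_d : ∀ i j, ContMDiff 𝓘(ℝ, EX) 𝓘(ℝ, ED) ∞ (d i j)
  smooth_h : ∀ i j k, ContMDiff 𝓘(ℝ, EX) 𝓘(ℝ, EH) ∞ (h i j k)
  d_mul_d : ∀ (i j k : ι) (x : X) (hi : x ∈ O i) (hj : x ∈ O j) (hk : x ∈ O k),
    d i j ⟨x, hi, hj⟩ * d j k ⟨x, hj, hk⟩ =
      𝒳.α (h i j k ⟨x, ⟨hi, hj⟩, hk⟩) * d i k ⟨x, hi, hk⟩
  h_mul_h : ∀ (i j k l : ι) (x : X) (hi : x ∈ O i) (hj : x ∈ O j) (hk : x ∈ O k) (hl : x ∈ O l),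
    h i j k ⟨x, ⟨hi, hj⟩, hk⟩ * h i k l ⟨x, ⟨hi, hk⟩, hl⟩ =
      𝒳.act (d i j ⟨x, hi, hj⟩) (h j k l ⟨x, ⟨hj, hk⟩, hl⟩) * h i j l ⟨x, ⟨hi, hj⟩, hl⟩

/-- A `B`-field `{B_i, δ_ij}` on the crossed module bundle gerbe with cocycle `{d_ij, h_ijk}`. -/
structure GerbeBField (𝒳 : CrossedModule (EH := EH) (ED := ED) H D) (O : ι → Opens X)
    (d : ∀ i j, (O i ⊓ O j : Opens X) → D) (h : ∀ i j k, (O i ⊓ O j ⊓ O k : Opens X) → H) where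
  B : ∀ i, TwoForm (EX := EX) (O i) EH
  δ : ∀ i j, TwoForm (EX := EX) (O i ⊓ O j) EH
  B_eq : ∀ (i j : ι) (x : X) (hi : x ∈ O i) (hj : x ∈ O j),
    B i ⟨x, hi⟩ =
      (𝒳.lieAct (d i j ⟨x, hi, hj⟩)).compContinuousAlternatingMap (B j ⟨x, hj⟩) +
        δ i j ⟨x, hi, hj⟩
  δ_eq : ∀ (i j k : ι) (x : X) (hi : x ∈ O i) (hj : x ∈ O j) (hk : x ∈ O k),
    δ i j ⟨x, hi, hj⟩ +
        (𝒳.lieAct (d i j ⟨x, hi, hj⟩)).compContinuousAlternatingMap (δ j k ⟨x, hj, hk⟩) =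
      (lieConj (h i j k ⟨x, ⟨hi, hj⟩, hk⟩)).compContinuousAlternatingMap (δ i k ⟨x, hi, hk⟩) +
        B i ⟨x, hi⟩ -
        (lieConj (h i j k ⟨x, ⟨hi, hj⟩, hk⟩)).compContinuousAlternatingMap (B i ⟨x, hi⟩)

/-- The transition functions `d_ij = τ_1` of the gerbe corresponding to a simplicial bundle. -/
def SimplicialBundle.d (P : SimplicialBundle (EX := EX) 𝒳 O) (i j : ι) (x : (O i ⊓ O j : Opens X)) : D :=
  (P.τ 0 ![i, j] ⟨x, mem_cechOpen_pair x.2.1 x.2.2⟩).vertex 0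

/-- The functions `h_ijk` of the gerbe corresponding to a simplicial bundle: the value of `τ` on a
`2`-simplex is the arrow `h_ijk : d_ik d_jk⁻¹ → d_ij`. -/
def SimplicialBundle.h (P : SimplicialBundle (EX := EX) 𝒳 O) (i j k : ι) (x : (O i ⊓ O j ⊓ O k : Opens X)) : H :=
  (P.τ 1 ![i, j, k] ⟨x, mem_cechOpen_triple x.2.1.1 x.2.1.2 x.2.2⟩).arrow 0 1

/-- The identification of simplicial `B̄`-fields with gerbe `B`-fields. As an element of
`Lie(Ḡ_1)`, a chain `d_1 → 1` is identified with *minus* its arrow in `Lie(H)`. Then `B_i` is the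
value of `B̄_1` on the component `O_i` of `X_0`, and `δ_ij` is the value of `∂_2 B̄_2 - ∂_1 B̄_2` on the
component `O_i ∩ O_j` of `X_1`. -/
structure Corresponds {P : SimplicialBundle (EX := EX) 𝒳 O} (Bbar : BBarField P) (b : GerbeBField (EX := EX) 𝒳 O P.d P.h) :
    Prop where
  B_eq : ∀ (i : ι) (x : X) (hi : x ∈ O i),
    b.B i ⟨x, hi⟩ =
      (-Nerve.lieArrow (𝒳 := 𝒳)).compContinuousAlternatingMap
        (Bbar.form 0 ![i] ⟨x, fun k => by fin_cases k; exact hi⟩)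
  δ_eq : ∀ (i j : ι) (x : X) (hi : x ∈ O i) (hj : x ∈ O j),
    b.δ i j ⟨x, hi, hj⟩ =
      ((-Nerve.lieArrow (𝒳 := 𝒳)).comp
        (Nerve.lieMap (Nerve.face 2) - Nerve.lieMap (Nerve.face 1))).compContinuousAlternatingMap
        (Bbar.form 1 ![i, j] ⟨x, mem_cechOpen_pair hi hj⟩)

end Cech

end CrossedGerbe

end

/-!
An element of `Ḡ_{n+1}` is a chain `d_{n+1} → ⋯ → d_0 = 1`, so it is freely determined by its arrows
`d_{k+1} → d_0`, `k = 0, …, n`. Passing to derivatives at `1`, an element of `Lie(Ḡ_{n+1})` is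
freely determined by its components along these arrows: `Nerve.lie_ext` gives uniqueness, and the
vectors `Nerve.lieSingle` give existence. In these components the simplicial operators fixing `d_0`
are mere reindexings (`Nerve.lieArrowZero_map`), and `g ∈ G_n` acts on the component along
`d_{k+1} → d_0` through its object `g_k` (`Nerve.lieArrowZero_barAct`).

The relations for the twisting function give the objects of `τ` on `O_{a_0} ∩ ⋯ ∩ O_{a_{n+1}}`: the
`k`-th one is `d_{a_0 a_{k+1}} (d_{a_1 a_{k+1}})⁻¹` (`SimplicialBundle.vertex_τ_mul_d`). Together with
the relations for the arrows of `τ` this yields the cocycle equations.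

Consequently a simplicial field is determined by its forms on the `O_i`: with `B_i` minus the arrow
of `B̄_1` on `O_i`, the component of `B̄_{n+1}` along `d_{k+1} → d_0` on `O_{a_0} ∩ ⋯ ∩ O_{a_n}` has
to be `-ᵈB_{a_k}` with `d = d_{a_0 a_k}` (`BBarField.lieArrowZero_eval`), and this formula satisfies
all the conditions for arbitrary `B_i` (`GerbeBField.toBBar`). On the gerbe the form `δ_ij` is
likewise determined by the `B_i`, as `B_i - ᵈB_j` with `d = d_ij`, which is the value of
`∂_2 B̄_2 - ∂_1 B̄_2` (`BBarField.lieArrow_face_sub_face`); the equation for `δ` on triple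
intersections then follows from `d_ij d_jk = α(h_ijk) d_ik`. Smoothness rests on the smooth dependence
of the derivative of `h ↦ ᵈh` at `1` on `d`, in operator norm (`CrossedModule.contMDiff_lieAct`).
-/

noncomputable section

namespace CrossedGerbe

/-! ### Finite products of manifolds -/

section PiManifold

variable {κ : Type*} [Fintype κ]
  {E : κ → Type*} [∀ i, NormedAddCommGroup (E i)] [∀ i, NormedSpace ℝ (E i)]
  {C : κ → Type*} [∀ i, TopologicalSpace (C i)] (I : ∀ i, ModelWithCorners ℝ (E i) (C i))
  {M : κ → Type*} [∀ i, TopologicalSpace (M i)] [∀ i, ChartedSpace (C i) (M i)]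

theorem eventually_writtenInExtChartAt_pi_apply (x : ∀ i, M i) (i : κ) :
    ∀ᶠ y in nhdsWithin (extChartAt (ModelWithCorners.pi I) x x) (range (ModelWithCorners.pi I)),
      writtenInExtChartAt (ModelWithCorners.pi I) (I i) x (fun z : ∀ i, M i => z i) y = y i := by
  filter_upwards [extChartAt_target_mem_nhdsWithin x] with y hy
  have h : y i = extChartAt (ModelWithCorners.pi I) x
      ((extChartAt (ModelWithCorners.pi I) x).symm y) i :=
    congrFun ((extChartAt (ModelWithCorners.pi I) x).right_inv hy).symm i
  exact h.symm

/-- The derivative of a projection of a finite product of manifolds is the projection. -/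
theorem hasMFDerivAt_pi_apply (x : ∀ i, M i) (i : κ) :
    HasMFDerivAt (ModelWithCorners.pi I) (I i) (fun z : ∀ i, M i => z i) x
      (ContinuousLinearMap.proj (R := ℝ) (φ := E) i) :=
  ⟨(continuous_apply i).continuousAt,
    ((ContinuousLinearMap.proj (R := ℝ) (φ := E) i).hasFDerivWithinAt).congr_of_eventuallyEq
      (eventually_writtenInExtChartAt_pi_apply I x i)
      ((eventually_writtenInExtChartAt_pi_apply I x i).self_of_nhdsWithin (mem_range_self _))⟩

theorem contMDiff_pi_apply (n : ℕ∞ω) (i : κ) :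
    ContMDiff (ModelWithCorners.pi I) (I i) n (fun z : ∀ i, M i => z i) := fun x =>
  contMDiffAt_iff.2 ⟨(continuous_apply i).continuousAt,
    ((ContinuousLinearMap.proj (R := ℝ) (φ := E) i).contDiff.contDiffWithinAt).congr_of_eventuallyEq
      (eventually_writtenInExtChartAt_pi_apply I x i)
      ((eventually_writtenInExtChartAt_pi_apply I x i).self_of_nhdsWithin (mem_range_self _))⟩

theorem contMDiff_pi {E' : Type*} [NormedAddCommGroup E'] [NormedSpace ℝ E']
    {C' : Type*} [TopologicalSpace C'] {J : ModelWithCorners ℝ E' C'}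
    {N : Type*} [TopologicalSpace N] [ChartedSpace C' N] {n : ℕ∞ω} {f : N → ∀ i, M i}
    (hf : ∀ i, ContMDiff J (I i) n (fun x => f x i)) :
    ContMDiff J (ModelWithCorners.pi I) n f := fun x =>
  contMDiffAt_iff.2 ⟨(continuous_pi fun i => (hf i).continuous).continuousAt,
    contDiffWithinAt_pi.2 fun i => (contMDiffAt_iff.1 (hf i x)).2⟩

end PiManifold

/-! ### Derivatives of composites -/

section ChainRule

variable {E E' E'' E₃ : Type*} [NormedAddCommGroup E] [NormedSpace ℝ E] [NormedAddCommGroup E']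
  [NormedSpace ℝ E'] [NormedAddCommGroup E''] [NormedSpace ℝ E'']
  [NormedAddCommGroup E₃] [NormedSpace ℝ E₃]
  {C C' C'' C₃ : Type*} [TopologicalSpace C] [TopologicalSpace C'] [TopologicalSpace C'']
  [TopologicalSpace C₃]
  {I : ModelWithCorners ℝ E C} {I' : ModelWithCorners ℝ E' C'} {I'' : ModelWithCorners ℝ E'' C''}
  {I₃ : ModelWithCorners ℝ E₃ C₃}
  {M M' M'' M₃ : Type*} [TopologicalSpace M] [ChartedSpace C M] [TopologicalSpace M']
  [ChartedSpace C' M'] [TopologicalSpace M''] [ChartedSpace C'' M'']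
  [TopologicalSpace M₃] [ChartedSpace C₃ M₃]

variable (I I') in
/-- The derivative of a map of manifolds with the tangent spaces regarded as the model spaces (which
they are by definition), so that its type does not depend on the map or the point. -/
def modelDeriv (f : M → M') (x : M) : E →L[ℝ] E' := mfderiv I I' f x

theorem modelDeriv_id (x : M) (v : E) : modelDeriv I I (fun z => z) x v = v :=
  DFunLike.congr_fun (mfderiv_id (I := I) (x := x)) v

theorem modelDeriv_const (c : M') (x : M) (v : E) : modelDeriv I I' (fun _ => c) x v = 0 :=
  DFunLike.congr_fun (mfderiv_const (I := I) (I' := I') (c := c) (x := x)) v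

theorem modelDeriv_prodMk {a : M → M'} {b : M → M''} (ha : ContMDiff I I' ∞ a)
    (hb : ContMDiff I I'' ∞ b) (x : M) (v : E) :
    modelDeriv I (I'.prod I'') (fun z => (a z, b z)) x v =
      (modelDeriv I I' a x v, modelDeriv I I'' b x v) :=
  DFunLike.congr_fun
    (mfderiv_prodMk (ha.mdifferentiable (by simp) x) (hb.mdifferentiable (by simp) x)) v

/-- The chain rule. -/
theorem modelDeriv_comp {g : M' → M''} {f : M → M'} {x : M} {y : M'}
    (hg : ContMDiff I' I'' ∞ g) (hf : ContMDiff I I' ∞ f) (hy : f x = y) (v : E) :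
    modelDeriv I I'' (fun z => g (f z)) x v = modelDeriv I' I'' g y (modelDeriv I I' f x v) := by
  subst hy
  have h := mfderiv_comp x (hg.mdifferentiable (by simp) _) (hf.mdifferentiable (by simp) _)
  exact DFunLike.congr_fun h v

/-- The derivative of a function of two functions `a`, `b` depends on the tangent vector only
through the derivatives of `a` and `b`. -/
theorem modelDeriv_comp_prodMk_congr {Ψ : M' × M'' → M₃} {a : M → M'} {b : M → M''}
    (hΨ : ContMDiff (I'.prod I'') I₃ ∞ Ψ) (ha : ContMDiff I I' ∞ a) (hb : ContMDiff I I'' ∞ b)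
    {x : M} {v w : E} (h₁ : modelDeriv I I' a x v = modelDeriv I I' a x w)
    (h₂ : modelDeriv I I'' b x v = modelDeriv I I'' b x w) :
    modelDeriv I I₃ (fun z => Ψ (a z, b z)) x v =
      modelDeriv I I₃ (fun z => Ψ (a z, b z)) x w := by
  rw [modelDeriv_comp hΨ (ha.prodMk hb) rfl, modelDeriv_comp hΨ (ha.prodMk hb) rfl,
    modelDeriv_prodMk ha hb, modelDeriv_prodMk ha hb, h₁, h₂]

/-- Along a tangent vector annihilated by the derivative of `a`, the derivative of `Ψ (a, b)` is that
of `Ψ (a₀, b)` with `a₀` fixed. -/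
theorem modelDeriv_comp_prodMk_of_left {Ψ : M' × M'' → M₃} {a : M → M'} {b : M → M''}
    (hΨ : ContMDiff (I'.prod I'') I₃ ∞ Ψ) (ha : ContMDiff I I' ∞ a) (hb : ContMDiff I I'' ∞ b)
    {x : M} {y : M''} (hy : b x = y) {v : E} (h₁ : modelDeriv I I' a x v = 0) :
    modelDeriv I I₃ (fun z => Ψ (a z, b z)) x v =
      modelDeriv I'' I₃ (fun z => Ψ (a x, z)) y (modelDeriv I I'' b x v) := by
  subst hy
  rw [modelDeriv_comp hΨ (ha.prodMk hb) rfl, modelDeriv_prodMk ha hb, h₁,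
    modelDeriv_comp (f := fun z => (a x, z)) hΨ (contMDiff_const.prodMk contMDiff_id) rfl,
    modelDeriv_prodMk (b := fun z => z) contMDiff_const contMDiff_id, modelDeriv_const,
    modelDeriv_id]

end ChainRule

section LieCalculus

variable {EH : Type*} [NormedAddCommGroup EH] [NormedSpace ℝ EH]
  {ED : Type*} [NormedAddCommGroup ED] [NormedSpace ℝ ED]
  {H : Type*} [TopologicalSpace H] [ChartedSpace EH H] [Group H]
  {D : Type*} [TopologicalSpace D] [ChartedSpace ED D] [Group D]

/-! ### The action of a crossed module on the Lie algebra -/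

namespace CrossedModule

variable (𝒳 : CrossedModule (EH := EH) (ED := ED) H D)

theorem contMDiff_act {E C N : Type*} [NormedAddCommGroup E] [NormedSpace ℝ E] [TopologicalSpace C]
    {J : ModelWithCorners ℝ E C} [TopologicalSpace N] [ChartedSpace C N] {f : N → D} {g : N → H}
    (hf : ContMDiff J 𝓘(ℝ, ED) ∞ f) (hg : ContMDiff J 𝓘(ℝ, EH) ∞ g) :
    ContMDiff J 𝓘(ℝ, EH) ∞ (fun x => 𝒳.act (f x) (g x)) :=
  𝒳.smooth_act.comp (hf.prodMk hg)

theorem contMDiff_act_left (d : D) :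
    ContMDiff 𝓘(ℝ, EH) 𝓘(ℝ, EH) ∞ (fun h : H => 𝒳.act d h) :=
  𝒳.contMDiff_act contMDiff_const contMDiff_id

theorem lieAct_one (Y : EH) : 𝒳.lieAct 1 Y = Y := by
  have h : (fun h : H => 𝒳.act 1 h) = id := by ext h; simp
  change modelDeriv _ _ (fun h : H => 𝒳.act 1 h) 1 Y = Y
  rw [h]
  exact modelDeriv_id 1 Y

theorem lieAct_mul (d d' : D) (Y : EH) : 𝒳.lieAct (d * d') Y = 𝒳.lieAct d (𝒳.lieAct d' Y) := by
  have h : (fun h : H => 𝒳.act (d * d') h) = fun h => 𝒳.act d (𝒳.act d' h) := by ext h; simp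
  change modelDeriv _ _ (fun h : H => 𝒳.act (d * d') h) 1 Y = _
  rw [h]
  exact modelDeriv_comp (𝒳.contMDiff_act_left d) (𝒳.contMDiff_act_left d') (map_one _) Y

theorem lieAct_α (h : H) : 𝒳.lieAct (𝒳.α h) = lieConj h := by
  change modelDeriv _ _ (fun x : H => 𝒳.act (𝒳.α h) x) 1 = modelDeriv _ _ (fun x => h * x * h⁻¹) 1
  simp only [𝒳.peiffer]

/-- The action on the Lie algebra depends smoothly on `d`, in the operator norm topology. -/
theorem contMDiff_lieAct [LieGroup 𝓘(ℝ, EH) ∞ H] [IsManifold 𝓘(ℝ, ED) ∞ D] :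
    ContMDiff 𝓘(ℝ, ED) 𝓘(ℝ, EH →L[ℝ] EH) ∞ 𝒳.lieAct := by
  intro d₀
  have h : ContMDiffAt 𝓘(ℝ, ED) 𝓘(ℝ, EH →L[ℝ] EH) ∞ (inTangentCoordinates 𝓘(ℝ, EH) 𝓘(ℝ, EH)
      (fun _ => (1 : H)) (fun d => 𝒳.act d 1) 𝒳.lieAct d₀) d₀ :=
    ContMDiffAt.mfderiv (I := 𝓘(ℝ, EH)) (I' := 𝓘(ℝ, EH)) (m := ∞) (n := ∞) (x₀ := d₀)
    (fun (d : D) (h : H) => 𝒳.act d h) (fun _ => (1 : H)) (𝒳.smooth_act (d₀, 1))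
    contMDiffAt_const (by simp)
  refine h.congr_of_eventuallyEq (Filter.Eventually.of_forall fun d => ?_)
  -- both base points are `1` for all `d`, so the changes of coordinates are trivial
  have h1 : (fun x : D => 𝒳.act x (1 : H)) = fun _ => 1 := by ext; simp
  rw [h1, inTangentCoordinates_eq (x₀ := d₀) (x := d) _ _ _ (mem_chart_source EH (1 : H))
    (mem_chart_source EH (1 : H))]
  ext Y
  simp only [ContinuousLinearMap.comp_apply]
  rw [VectorBundleCore.coordChange_self, VectorBundleCore.coordChange_self]
  all_goals exact mem_chart_source _ _

end CrossedModule

/-! ### Products, faces and arrows of chains -/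

namespace Nerve

variable {𝒳 : CrossedModule (EH := EH) (ED := ED) H D} {m n : ℕ}
  {E C N : Type*} [NormedAddCommGroup E] [NormedSpace ℝ E] [TopologicalSpace C]
  {J : ModelWithCorners ℝ E C} [TopologicalSpace N] [ChartedSpace C N]

theorem vertex_one (i : Fin (n + 1)) : (1 : Nerve 𝒳 n).vertex i = 1 := by
  have h := vertex_mul (1 : Nerve 𝒳 n) 1 i
  rwa [one_mul, left_eq_mul] at h

theorem arrow_one (i j : Fin (n + 1)) : (1 : Nerve 𝒳 n).arrow i j = 1 := by
  have h := arrow_mul (1 : Nerve 𝒳 n) 1 i j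
  rwa [one_mul, vertex_one, map_one, MulAut.one_apply, left_eq_mul] at h

theorem arrow_self (g : Nerve 𝒳 n) (i : Fin (n + 1)) : g.arrow i i = 1 := by
  simp [arrow]

theorem vertex_last (g : Nerve 𝒳 n) : g.vertex (Fin.last n) = g.1 := by
  simp [vertex, fromTop]

theorem arrow_castSucc_last (g : Nerve 𝒳 n) (i : Fin n) :
    g.arrow i.castSucc (Fin.last n) = g.2 i := by
  simp [arrow, fromTop]

theorem map_apply_one (f : Fin (m + 1) → Fin (n + 1)) : map f (1 : Nerve 𝒳 n) = 1 :=
  ext_arrow (by rw [vertex_map, vertex_one, vertex_one])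
    fun i => by rw [arrow_map, arrow_one, arrow_one]

/-- The composite of the last face maps sends a chain to its final object `d_0`. -/
theorem bottom_fst : ∀ (n : ℕ) (g : Nerve 𝒳 n), (bottom n g).1 = g.vertex 0
  | 0, g => (vertex_last g).symm
  | n + 1, g => by
    rw [bottom, bottom_fst n, face, vertex_map, Fin.succAbove_of_castSucc_lt _ _ (Fin.last_pos)]
    rfl

theorem vertex_inv (g : Nerve 𝒳 n) (i : Fin (n + 1)) : g⁻¹.vertex i = (g.vertex i)⁻¹ := by
  rw [eq_inv_iff_mul_eq_one, ← vertex_mul, inv_mul_cancel, vertex_one]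

theorem arrow_inv (g : Nerve 𝒳 n) (i j : Fin (n + 1)) :
    g⁻¹.arrow i j = 𝒳.act (g.vertex j)⁻¹ (g.arrow i j)⁻¹ := by
  have h := arrow_mul g⁻¹ g i j
  rw [inv_mul_cancel, arrow_one, vertex_inv] at h
  rw [map_inv, eq_inv_iff_mul_eq_one, ← h]

theorem vertex_barAct (g : Nerve 𝒳 n) (x : Nerve 𝒳 (n + 1)) (i : Fin (n + 2)) :
    (barAct g x).vertex i =
      g.vertex (Fin.predAbove 0 i) * x.vertex i * (g.vertex (Fin.predAbove 0 i))⁻¹ := by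
  rw [barAct, vertex_mul, vertex_mul, vertex_inv, degen, vertex_map]

/-- The arrows of `ᵍx`. If the object `x_i` is `1`, then the first two factors cancel. -/
theorem arrow_barAct (g : Nerve 𝒳 n) (x : Nerve 𝒳 (n + 1)) (i j : Fin (n + 2)) :
    (barAct g x).arrow i j =
      g.arrow (Fin.predAbove 0 i) (Fin.predAbove 0 j) *
        𝒳.act (g.vertex (Fin.predAbove 0 j) * x.vertex i * (g.vertex (Fin.predAbove 0 j))⁻¹)
          (g.arrow (Fin.predAbove 0 i) (Fin.predAbove 0 j))⁻¹ *
        𝒳.act (g.vertex (Fin.predAbove 0 j)) (x.arrow i j) := by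
  rw [barAct, arrow_mul, arrow_mul, arrow_inv, vertex_mul, degen, vertex_map, arrow_map,
    ← arrow_target x i j]
  simp [𝒳.peiffer, mul_assoc]

theorem barAct_one (g : Nerve 𝒳 n) : barAct g 1 = 1 := by
  rw [barAct, mul_one, mul_inv_cancel]

/-- The chain with arrows `(u i)⁻¹ * u j : d_j → d_i` and objects `α(u j)⁻¹`. For `u 0 = 1` it is
the element of `Ḡ_n` with arrows `u j : d_j → d_0`. -/
def ofArrows (𝒳 : CrossedModule (EH := EH) (ED := ED) H D) (u : Fin (n + 1) → H) : Nerve 𝒳 n :=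
  ((𝒳.α (u (Fin.last n)))⁻¹, fun i => (u i.castSucc)⁻¹ * u (Fin.last n))

theorem fromTop_ofArrows (u : Fin (n + 1) → H) (i : Fin (n + 1)) :
    (ofArrows 𝒳 u).fromTop i = (u i)⁻¹ * u (Fin.last n) := by
  refine Fin.lastCases ?_ (fun i => ?_) i <;> simp [fromTop, ofArrows]

theorem arrow_ofArrows (u : Fin (n + 1) → H) (i j : Fin (n + 1)) :
    (ofArrows 𝒳 u).arrow i j = (u i)⁻¹ * u j := by
  simp [arrow, fromTop_ofArrows]

theorem vertex_ofArrows (u : Fin (n + 1) → H) (i : Fin (n + 1)) :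
    (ofArrows 𝒳 u).vertex i = (𝒳.α (u i))⁻¹ := by
  rw [vertex, fromTop_ofArrows]
  simp [ofArrows]

theorem ofArrows_mulSingle_one (k : Fin (n + 1)) :
    ofArrows 𝒳 (Pi.mulSingle k (1 : H) : Fin (n + 1) → H) = 1 :=
  ext_arrow (by rw [vertex_ofArrows, vertex_one]; simp)
    fun i => by rw [arrow_ofArrows, arrow_one]; simp

/-! ### The nerve as a manifold -/

theorem contMDiff_fst (k : ℕ∞ω) :
    ContMDiff (nerveModel 𝒳 n) 𝓘(ℝ, ED) k (fun g : Nerve 𝒳 n => g.1) :=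
  _root_.contMDiff_fst (M := D) (N := Fin n → H)

theorem contMDiff_snd_apply (k : ℕ∞ω) (i : Fin n) :
    ContMDiff (nerveModel 𝒳 n) 𝓘(ℝ, EH) k (fun g : Nerve 𝒳 n => g.2 i) :=
  (contMDiff_pi_apply (fun _ : Fin n => 𝓘(ℝ, EH)) k i).comp
    (_root_.contMDiff_snd (M := D) (N := Fin n → H))

theorem contMDiff_mk {k : ℕ∞ω} {f : N → Nerve 𝒳 n} (h₁ : ContMDiff J 𝓘(ℝ, ED) k fun x => (f x).1)
    (h₂ : ∀ i, ContMDiff J 𝓘(ℝ, EH) k fun x => (f x).2 i) : ContMDiff J (nerveModel 𝒳 n) k f :=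
  ContMDiff.prodMk (M' := D) (N' := Fin n → H) h₁
    (contMDiff_pi (I := fun _ : Fin n => 𝓘(ℝ, EH)) h₂)

theorem modelDeriv_fst (g : Nerve 𝒳 n) (V : LieNerve 𝒳 n) :
    modelDeriv (nerveModel 𝒳 n) 𝓘(ℝ, ED) (fun g : Nerve 𝒳 n => g.1) g V = V.1 :=
  DFunLike.congr_fun (_root_.mfderiv_fst (M := D) (M' := Fin n → H) (I := 𝓘(ℝ, ED))
    (I' := ModelWithCorners.pi fun _ : Fin n => 𝓘(ℝ, EH)) (x := g)) V

theorem modelDeriv_snd_apply (g : Nerve 𝒳 n) (V : LieNerve 𝒳 n) (i : Fin n) :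
    modelDeriv (nerveModel 𝒳 n) 𝓘(ℝ, EH) (fun g : Nerve 𝒳 n => g.2 i) g V = V.2 i :=
  have h := (hasMFDerivAt_pi_apply (fun _ : Fin n => 𝓘(ℝ, EH)) (g.2 : Fin n → H) i).comp
    (g : D × (Fin n → H)) (hasMFDerivAt_snd (M := D) (M' := Fin n → H) (I := 𝓘(ℝ, ED))
      (I' := ModelWithCorners.pi fun _ : Fin n => 𝓘(ℝ, EH)) g)
  DFunLike.congr_fun h.mfderiv V

/-- A map into the nerve is smooth if the objects and the arrows of its values are. -/
theorem contMDiff_of_vertex_of_arrow {f : N → Nerve 𝒳 n}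
    (h₁ : ∀ i, ContMDiff J 𝓘(ℝ, ED) ∞ fun x => (f x).vertex i)
    (h₂ : ∀ i j, ContMDiff J 𝓘(ℝ, EH) ∞ fun x => (f x).arrow i j) :
    ContMDiff J (nerveModel 𝒳 n) ∞ f :=
  contMDiff_mk (by simpa only [vertex_last] using h₁ (Fin.last n))
    fun i => by simpa only [arrow_castSucc_last] using h₂ i.castSucc (Fin.last n)

theorem contMDiff_mulSingle (k j : Fin (n + 1)) :
    ContMDiff 𝓘(ℝ, EH) 𝓘(ℝ, EH) ∞
      (fun h : H => (Pi.mulSingle k h : Fin (n + 1) → H) j) := by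
  rcases eq_or_ne j k with rfl | hj
  · simp only [Pi.mulSingle_eq_same]
    exact contMDiff_id
  · simpa [Pi.mulSingle_eq_of_ne hj] using contMDiff_const

theorem contMDiff_fromTop (i : Fin (n + 1)) :
    ContMDiff (nerveModel 𝒳 n) 𝓘(ℝ, EH) ∞ (fun g : Nerve 𝒳 n => g.fromTop i) := by
  refine Fin.lastCases ?_ (fun i => ?_) i
  · simpa [fromTop] using contMDiff_const
  · simpa [fromTop] using contMDiff_snd_apply (𝒳 := 𝒳) ∞ i

/-! ### Components of tangent vectors of the nerve -/

/-- The derivative at `1` of the map sending a chain to its final object `d_0`. -/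
def lieVertex (𝒳 : CrossedModule (EH := EH) (ED := ED) H D) (n : ℕ) : LieNerve 𝒳 n →L[ℝ] ED :=
  modelDeriv (nerveModel 𝒳 n) 𝓘(ℝ, ED) (fun g : Nerve 𝒳 n => g.vertex 0) 1

/-- The derivative at `1` of the map sending a chain to its composite arrow `d_j → d_0`. -/
def lieArrowZero (𝒳 : CrossedModule (EH := EH) (ED := ED) H D) {n : ℕ} (j : Fin (n + 1)) :
    LieNerve 𝒳 n →L[ℝ] EH :=
  modelDeriv (nerveModel 𝒳 n) 𝓘(ℝ, EH) (fun g : Nerve 𝒳 n => g.arrow 0 j) 1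

theorem lieArrowZero_zero (V : LieNerve 𝒳 n) : lieArrowZero 𝒳 (0 : Fin (n + 1)) V = 0 := by
  simp only [lieArrowZero, arrow_self]
  exact modelDeriv_const _ _ V

theorem contMDiff_vertex [LieGroup 𝓘(ℝ, ED) ∞ D] (i : Fin (n + 1)) :
    ContMDiff (nerveModel 𝒳 n) 𝓘(ℝ, ED) ∞ (fun g : Nerve 𝒳 n => g.vertex i) :=
  (𝒳.smooth_α.comp (contMDiff_fromTop i)).mul (contMDiff_fst ∞)

/-- The Lie algebra of `Ḡ_n` consists of the tangent vectors along which `d_0` is stationary. -/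
theorem mem_lieBar_iff [LieGroup 𝓘(ℝ, ED) ∞ D] (V : LieNerve 𝒳 n) :
    V ∈ lieBar 𝒳 n ↔ lieVertex 𝒳 n V = 0 := by
  have hb : ContMDiff (nerveModel 𝒳 n) (nerveModel 𝒳 0) ∞ (bottom (𝒳 := 𝒳) n) :=
    contMDiff_mk (by simpa only [bottom_fst] using contMDiff_vertex 0) fun i => i.elim0
  have h : (lieMap (bottom (𝒳 := 𝒳) n) V).1 = lieVertex 𝒳 n V := by
    have := modelDeriv_comp (x := 1) (contMDiff_fst (𝒳 := 𝒳) ∞) hb rfl V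
    simp only [bottom_fst] at this
    rw [lieVertex, this]
    exact (modelDeriv_fst _ _).symm
  rw [← h]
  change lieMap (bottom (𝒳 := 𝒳) n) V = 0 ↔ _
  exact ⟨fun h => by rw [h]; rfl, fun h => Prod.ext h (funext fun i => i.elim0)⟩

variable [LieGroup 𝓘(ℝ, EH) ∞ H]

theorem contMDiff_arrow (i j : Fin (n + 1)) :
    ContMDiff (nerveModel 𝒳 n) 𝓘(ℝ, EH) ∞ (fun g : Nerve 𝒳 n => g.arrow i j) :=
  (contMDiff_fromTop i).mul (contMDiff_fromTop j).inv

variable [LieGroup 𝓘(ℝ, ED) ∞ D]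

theorem contMDiff_map (f : Fin (m + 1) → Fin (n + 1)) :
    ContMDiff (nerveModel 𝒳 n) (nerveModel 𝒳 m) ∞ (map (𝒳 := 𝒳) f) :=
  contMDiff_of_vertex_of_arrow (fun i => by simpa only [vertex_map] using contMDiff_vertex _)
    fun i j => by simpa only [arrow_map] using contMDiff_arrow _ _

/-- A tangent vector of the nerve at `1` is determined by its components along `d_0` and along the
arrows `d_j → d_0`, because the coordinates of a chain are functions of `d_0` and these arrows. -/
theorem lie_ext {V W : LieNerve 𝒳 n} (h₁ : lieVertex 𝒳 n V = lieVertex 𝒳 n W)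
    (h₂ : ∀ j : Fin (n + 1), lieArrowZero 𝒳 j V = lieArrowZero 𝒳 j W) : V = W := by
  refine Prod.ext ?_ (funext fun i => ?_)
  · have e : (fun g : Nerve 𝒳 n => g.1) =
        fun g => (𝒳.α (g.arrow 0 (Fin.last n)))⁻¹ * g.vertex 0 := by
      ext g
      rw [← arrow_target g 0 (Fin.last n), inv_mul_cancel_left, vertex_last]
    rw [← modelDeriv_fst 1 V, ← modelDeriv_fst 1 W, e]
    exact modelDeriv_comp_prodMk_congr (Ψ := fun p : H × D => (𝒳.α p.1)⁻¹ * p.2)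
      ((𝒳.smooth_α.comp _root_.contMDiff_fst).inv.mul _root_.contMDiff_snd)
      (contMDiff_arrow 0 (Fin.last n)) (contMDiff_vertex 0) (h₂ _) h₁
  · have e : (fun g : Nerve 𝒳 n => g.2 i) =
        fun g => (g.arrow 0 i.castSucc)⁻¹ * g.arrow 0 (Fin.last n) := by
      ext g
      rw [← arrow_comp g 0 i.castSucc (Fin.last n), inv_mul_cancel_left, arrow_castSucc_last]
    rw [← modelDeriv_snd_apply 1 V, ← modelDeriv_snd_apply 1 W, e]
    exact modelDeriv_comp_prodMk_congr (Ψ := fun p : H × H => p.1⁻¹ * p.2)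
      (_root_.contMDiff_fst.inv.mul _root_.contMDiff_snd)
      (contMDiff_arrow 0 i.castSucc) (contMDiff_arrow 0 (Fin.last n)) (h₂ _) (h₂ _)

theorem lieVertex_map {f : Fin (m + 1) → Fin (n + 1)} (hf : f 0 = 0) (V : LieNerve 𝒳 n) :
    lieVertex 𝒳 m (lieMap (map f) V) = lieVertex 𝒳 n V := by
  have h := modelDeriv_comp (x := 1) (contMDiff_vertex (𝒳 := 𝒳) 0) (contMDiff_map f)
    (map_apply_one f) V
  simp only [vertex_map, hf] at h
  exact h.symm

theorem lieArrowZero_map {f : Fin (m + 1) → Fin (n + 1)} (hf : f 0 = 0) (j : Fin (m + 1))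
    (V : LieNerve 𝒳 n) : lieArrowZero 𝒳 j (lieMap (map f) V) = lieArrowZero 𝒳 (f j) V := by
  have h := modelDeriv_comp (x := 1) (contMDiff_arrow (𝒳 := 𝒳) 0 j) (contMDiff_map f)
    (map_apply_one f) V
  simp only [arrow_map, hf] at h
  exact h.symm

/-! ### The action on the Lie algebra of the kernel -/

theorem contMDiff_barAct (g : Nerve 𝒳 n) :
    ContMDiff (nerveModel 𝒳 (n + 1)) (nerveModel 𝒳 (n + 1)) ∞ (barAct g) := by
  refine contMDiff_of_vertex_of_arrow (fun i => ?_) fun i j => ?_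
  · simp only [vertex_barAct]
    exact (contMDiff_const.mul (contMDiff_vertex i)).mul contMDiff_const
  · simp only [arrow_barAct]
    exact (contMDiff_const.mul (𝒳.contMDiff_act
      ((contMDiff_const.mul (contMDiff_vertex i)).mul contMDiff_const) contMDiff_const)).mul
      (𝒳.contMDiff_act contMDiff_const (contMDiff_arrow i j))

theorem lieVertex_barAct (g : Nerve 𝒳 n) {V : LieNerve 𝒳 (n + 1)}
    (hV : lieVertex 𝒳 (n + 1) V = 0) : lieVertex 𝒳 (n + 1) (lieMap (barAct g) V) = 0 := by
  have h := modelDeriv_comp (x := 1) (contMDiff_vertex (𝒳 := 𝒳) 0) (contMDiff_barAct g)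
    (barAct_one g) V
  simp only [vertex_barAct] at h
  have h' := modelDeriv_comp (x := 1)
    (g := fun d : D => g.vertex (Fin.predAbove 0 0) * d * (g.vertex (Fin.predAbove 0 0))⁻¹)
    (I' := 𝓘(ℝ, ED)) (I'' := 𝓘(ℝ, ED))
    ((contMDiff_const.mul contMDiff_id).mul contMDiff_const)
    (contMDiff_vertex (𝒳 := 𝒳) (n := n + 1) 0) rfl V
  refine h.symm.trans (h'.trans ?_)
  change modelDeriv _ _ _ _ (lieVertex 𝒳 (n + 1) V) = 0
  rw [hV, map_zero]

/-- On `Lie(Ḡ_{n+1})` an element `g` acts on the component along `d_{j+1} → d_0` through its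
object `g_j`. -/
theorem lieArrowZero_barAct (g : Nerve 𝒳 n) {V : LieNerve 𝒳 (n + 1)}
    (hV : lieVertex 𝒳 (n + 1) V = 0) (j : Fin (n + 1)) :
    lieArrowZero 𝒳 j.succ (lieMap (barAct g) V) =
      𝒳.lieAct (g.vertex j) (lieArrowZero 𝒳 j.succ V) := by
  have h := modelDeriv_comp (x := 1) (contMDiff_arrow (𝒳 := 𝒳) 0 j.succ) (contMDiff_barAct g)
    (barAct_one g) V
  simp only [arrow_barAct, Fin.predAbove_zero_succ] at h
  refine h.symm.trans ?_
  have h' := modelDeriv_comp_prodMk_of_left (x := 1) (I₃ := 𝓘(ℝ, EH))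
    (Ψ := fun p : D × H => g.arrow (Fin.predAbove 0 0) j *
      𝒳.act (g.vertex j * p.1 * (g.vertex j)⁻¹) (g.arrow (Fin.predAbove 0 0) j)⁻¹ *
      𝒳.act (g.vertex j) p.2)
    ((contMDiff_const.mul (𝒳.contMDiff_act
      ((contMDiff_const.mul _root_.contMDiff_fst).mul contMDiff_const) contMDiff_const)).mul
      (𝒳.contMDiff_act contMDiff_const _root_.contMDiff_snd))
    (contMDiff_vertex (𝒳 := 𝒳) (n := n + 1) 0) (contMDiff_arrow 0 j.succ) (arrow_one _ _) hV
  refine h'.trans ?_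
  simp only [vertex_one, mul_one, mul_inv_cancel, map_one, MulAut.one_apply, one_mul]
  rfl

/-! ### Chains with prescribed arrows -/

theorem contMDiff_ofArrows_mulSingle (k : Fin (n + 1)) :
    ContMDiff 𝓘(ℝ, EH) (nerveModel 𝒳 n) ∞
      (fun h : H => ofArrows 𝒳 (Pi.mulSingle k h : Fin (n + 1) → H)) := by
  refine contMDiff_of_vertex_of_arrow (fun i => ?_) fun i j => ?_
  · simp only [vertex_ofArrows]
    exact (𝒳.smooth_α.comp (contMDiff_mulSingle k i)).inv
  · simp only [arrow_ofArrows]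
    exact (contMDiff_mulSingle k i).inv.mul (contMDiff_mulSingle k j)

/-- The derivative at `1` of the map sending `h` to the element of `Ḡ_n` with arrow
`h : d_{k+1} → d_0` and all other arrows to `d_0` trivial. -/
def lieSingle (𝒳 : CrossedModule (EH := EH) (ED := ED) H D) (k : Fin n) : EH →L[ℝ] LieNerve 𝒳 n :=
  modelDeriv 𝓘(ℝ, EH) (nerveModel 𝒳 n)
    (fun h : H => ofArrows 𝒳 (Pi.mulSingle k.succ h : Fin (n + 1) → H)) 1

theorem lieVertex_lieSingle (k : Fin n) (Y : EH) : lieVertex 𝒳 n (lieSingle 𝒳 k Y) = 0 := by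
  have h := modelDeriv_comp (x := (1 : H)) (contMDiff_vertex (𝒳 := 𝒳) 0)
    (contMDiff_ofArrows_mulSingle k.succ) (ofArrows_mulSingle_one k.succ) Y
  refine h.symm.trans ?_
  simp only [vertex_ofArrows, Pi.mulSingle_eq_of_ne (Fin.succ_ne_zero k).symm, map_one, inv_one]
  exact modelDeriv_const _ _ Y

theorem lieArrowZero_lieSingle (k j : Fin n) (Y : EH) :
    lieArrowZero 𝒳 j.succ (lieSingle 𝒳 k Y) = if j = k then Y else 0 := by
  have h := modelDeriv_comp (x := (1 : H)) (contMDiff_arrow (𝒳 := 𝒳) 0 j.succ)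
    (contMDiff_ofArrows_mulSingle k.succ) (ofArrows_mulSingle_one k.succ) Y
  refine h.symm.trans ?_
  simp only [arrow_ofArrows, Pi.mulSingle_eq_of_ne (Fin.succ_ne_zero k).symm, inv_one, one_mul]
  split_ifs with hj
  · subst hj
    simp only [Pi.mulSingle_eq_same]
    exact modelDeriv_id _ Y
  · simp only [Pi.mulSingle_eq_of_ne (fun h => hj (Fin.succ_injective _ h) : j.succ ≠ k.succ)]
    exact modelDeriv_const _ _ Y

end Nerve

end LieCalculus

section Bundle

variable {EH : Type*} [NormedAddCommGroup EH] [NormedSpace ℝ EH]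
  {ED : Type*} [NormedAddCommGroup ED] [NormedSpace ℝ ED]
  {EX : Type*} [NormedAddCommGroup EX] [NormedSpace ℝ EX]
  {H : Type*} [TopologicalSpace H] [ChartedSpace EH H] [Group H]
  {D : Type*} [TopologicalSpace D] [ChartedSpace ED D] [Group D]
  {X : Type*} [TopologicalSpace X] [ChartedSpace EX X] {ι : Type*}
  {𝒳 : CrossedModule (EH := EH) (ED := ED) H D} {O : ι → Opens X}

/-! ### The cocycle of a twisting function -/

theorem mem_of_cechOpen {n : ℕ} {a : Fin (n + 1) → ι} {x : X} (hx : x ∈ cechOpen O a)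
    (k : Fin (n + 1)) : x ∈ O (a k) := hx k

theorem mem_inf_of_cechOpen {n : ℕ} {a : Fin (n + 1) → ι} {x : X} (hx : x ∈ cechOpen O a)
    (k l : Fin (n + 1)) : x ∈ O (a k) ⊓ O (a l) := ⟨hx k, hx l⟩

theorem mem_cechOpen_comp {m n : ℕ} {a : Fin (n + 1) → ι} {x : X} (hx : x ∈ cechOpen O a)
    (f : Fin (m + 1) → Fin (n + 1)) : x ∈ cechOpen O (a ∘ f) := fun k => hx (f k)

theorem mem_cechOpen_single {i : ι} {x : X} (hi : x ∈ O i) : x ∈ cechOpen O ![i] := fun k => by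
  fin_cases k; exact hi

namespace SimplicialBundle

variable (P : SimplicialBundle (EX := EX) 𝒳 O)

theorem τ_congr {n : ℕ} {a a' : Fin (n + 2) → ι} (ha : a = a') {x : X} (hx : x ∈ cechOpen O a)
    (hx' : x ∈ cechOpen O a') : P.τ n a ⟨x, hx⟩ = P.τ n a' ⟨x, hx'⟩ := by
  subst ha; rfl

theorem d_congr {i i' j j' : ι} (hi : i = i') (hj : j = j') {x : X} (hx : x ∈ O i ⊓ O j)
    (hx' : x ∈ O i' ⊓ O j') : P.d i j ⟨x, hx⟩ = P.d i' j' ⟨x, hx'⟩ := by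
  subst hi hj; rfl

theorem d_eq {a : Fin 2 → ι} {x : X} (hx : x ∈ cechOpen O a) :
    P.d (a 0) (a 1) ⟨x, hx 0, hx 1⟩ = (P.τ 0 a ⟨x, hx⟩).vertex 0 :=
  congrArg (fun g => Nerve.vertex g 0)
    (P.τ_congr (by ext k; fin_cases k <;> rfl) _ _)

theorem h_eq {a : Fin 3 → ι} {x : X} (hx : x ∈ cechOpen O a) :
    P.h (a 0) (a 1) (a 2) ⟨x, ⟨hx 0, hx 1⟩, hx 2⟩ = (P.τ 1 a ⟨x, hx⟩).arrow 0 1 :=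
  congrArg (fun g => Nerve.arrow g 0 1)
    (P.τ_congr (by ext k; fin_cases k <;> rfl) _ _)

theorem d_self {i : ι} {x : X} (hx : x ∈ O i ⊓ O i) : P.d i i ⟨x, hx⟩ = 1 := by
  have h := P.degen_zero 0 (fun _ => i) ⟨x, fun _ => hx.1⟩
  have h' := P.d_eq (a := fun _ => i) (x := x) fun _ => hx.1
  exact h'.trans ((congrArg (fun g => Nerve.vertex g 0) h).trans (Nerve.vertex_one 0))

/-- The final object of `τ(x)` on `O_{a_0} ∩ ⋯ ∩ O_{a_{n+1}}` is `d_{a_0 a_1}`. -/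
theorem vertex_τ_zero : ∀ (n : ℕ) (a : Fin (n + 2) → ι) (x : X) (hx : x ∈ cechOpen O a),
    (P.τ n a ⟨x, hx⟩).vertex 0 = P.d (a 0) (a 1) ⟨x, mem_inf_of_cechOpen hx 0 1⟩
  | 0, a, x, hx => (P.d_eq hx).symm
  | n + 1, a, x, hx => by
    have h := congrArg (fun g => Nerve.vertex g 0) (P.face_succ n a ⟨x, hx⟩ (Fin.last n))
    simp only [Nerve.face, Nerve.vertex_map] at h
    exact h.trans (vertex_τ_zero n _ x _)

/-- The objects of `τ(x)` on `O_{a_0} ∩ ⋯ ∩ O_{a_{n+1}}` are the elements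
`d_{a_0 a_{k+1}} (d_{a_1 a_{k+1}})⁻¹`. -/
theorem vertex_τ_mul_d : ∀ (n : ℕ) (a : Fin (n + 2) → ι) (x : X) (hx : x ∈ cechOpen O a)
    (k : Fin (n + 1)), (P.τ n a ⟨x, hx⟩).vertex k *
      P.d (a 1) (a k.succ) ⟨x, mem_inf_of_cechOpen hx 1 k.succ⟩ =
      P.d (a 0) (a k.succ) ⟨x, mem_inf_of_cechOpen hx 0 k.succ⟩ := by
  have h0 : ∀ (n : ℕ) (a : Fin (n + 2) → ι) (x : X) (hx : x ∈ cechOpen O a),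
      (P.τ n a ⟨x, hx⟩).vertex 0 * P.d (a 1) (a (Fin.succ 0)) ⟨x, mem_inf_of_cechOpen hx 1 (Fin.succ 0)⟩ =
        P.d (a 0) (a (Fin.succ 0)) ⟨x, mem_inf_of_cechOpen hx 0 (Fin.succ 0)⟩ := fun n a x hx => by
    have h : P.d (a 1) (a (Fin.succ 0)) ⟨x, mem_inf_of_cechOpen hx 1 _⟩ = 1 := P.d_self _
    rw [vertex_τ_zero, h, mul_one]
    rfl
  intro n
  induction n with
  | zero =>
    intro a x hx k
    obtain rfl : k = 0 := Fin.fin_one_eq_zero k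
    exact h0 0 a x hx
  | succ n ih =>
    intro a x hx k
    refine Fin.cases (h0 _ a x hx) (fun k => ?_) k
    have h := congrArg (fun g => Nerve.vertex g k) (P.face_zero n a ⟨x, hx⟩)
    simp only [Nerve.face, Nerve.vertex_map, Nerve.vertex_mul, Nerve.vertex_inv] at h
    have e : Fin.succAbove (1 : Fin (n + 3)) k.succ = k.succ.succ :=
      Fin.succAbove_of_le_castSucc _ _ (by simp [Fin.le_def])
    have h₁ : (P.τ n (a ∘ Fin.succAbove 1) ⟨x, fun i => hx _⟩).vertex k *
        P.d (a 2) (a k.succ.succ) ⟨x, mem_inf_of_cechOpen hx 2 k.succ.succ⟩ =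
          P.d (a 0) (a k.succ.succ) ⟨x, mem_inf_of_cechOpen hx 0 k.succ.succ⟩ :=
      (congrArg _ (P.d_congr rfl (congrArg a e.symm) _ ⟨hx _, hx _⟩)).trans
        ((ih (a ∘ Fin.succAbove 1) x (fun i => hx _) k).trans
          (P.d_congr rfl (congrArg a e) ⟨hx _, hx _⟩ _))
    have h₂ : (P.τ n (a ∘ Fin.succAbove 0) ⟨x, fun i => hx _⟩).vertex k *
        P.d (a 2) (a k.succ.succ) ⟨x, mem_inf_of_cechOpen hx 2 k.succ.succ⟩ =
          P.d (a 1) (a k.succ.succ) ⟨x, mem_inf_of_cechOpen hx 1 k.succ.succ⟩ :=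
      ih (a ∘ Fin.succAbove 0) x (fun i => hx _) k
    rw [Fin.succAbove_zero] at h
    rw [h, ← h₁, ← h₂, mul_assoc]
    exact congrArg _ (inv_mul_cancel_left _ _)

theorem contMDiff_d (i j : ι) : ContMDiff 𝓘(ℝ, EX) 𝓘(ℝ, ED) ∞ (P.d i j) := by
  have h : O i ⊓ O j ≤ cechOpen O ![i, j] := fun x hx => mem_cechOpen_pair hx.1 hx.2
  have e : P.d i j = fun x => (P.τ 0 ![i, j] (Opens.inclusion h x)).1 :=
    funext fun x => Nerve.vertex_last _
  rw [e]
  exact (Nerve.contMDiff_fst ∞).comp ((P.smooth 0 _).comp (contMDiff_inclusion h))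

theorem contMDiff_h (i j k : ι) : ContMDiff 𝓘(ℝ, EX) 𝓘(ℝ, EH) ∞ (P.h i j k) := by
  have h : O i ⊓ O j ⊓ O k ≤ cechOpen O ![i, j, k] := fun x hx =>
    mem_cechOpen_triple hx.1.1 hx.1.2 hx.2
  have e : P.h i j k = fun x => (P.τ 1 ![i, j, k] (Opens.inclusion h x)).2 0 :=
    funext fun x => Nerve.arrow_castSucc_last _ 0
  rw [e]
  exact (Nerve.contMDiff_snd_apply ∞ 0).comp ((P.smooth 1 _).comp (contMDiff_inclusion h))

theorem d_mul_d {i j k : ι} {x : X} (hi : x ∈ O i) (hj : x ∈ O j) (hk : x ∈ O k) :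
    P.d i j ⟨x, hi, hj⟩ * P.d j k ⟨x, hj, hk⟩ =
      𝒳.α (P.h i j k ⟨x, ⟨hi, hj⟩, hk⟩) * P.d i k ⟨x, hi, hk⟩ := by
  have hx : x ∈ cechOpen O ![i, j, k] := mem_cechOpen_triple hi hj hk
  have h₀ : (P.τ 1 ![i, j, k] ⟨x, hx⟩).vertex 0 = P.d i j ⟨x, hi, hj⟩ := P.vertex_τ_zero 1 _ x hx
  have h₁ : (P.τ 1 ![i, j, k] ⟨x, hx⟩).vertex 1 * P.d j k ⟨x, hj, hk⟩ = P.d i k ⟨x, hi, hk⟩ :=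
    P.vertex_τ_mul_d 1 _ x hx 1
  rw [← h₁, ← h₀, ← Nerve.arrow_target _ 0 1, mul_assoc]
  rfl

theorem h_mul_h {i j k l : ι} {x : X} (hi : x ∈ O i) (hj : x ∈ O j) (hk : x ∈ O k)
    (hl : x ∈ O l) : P.h i j k ⟨x, ⟨hi, hj⟩, hk⟩ * P.h i k l ⟨x, ⟨hi, hk⟩, hl⟩ =
      𝒳.act (P.d i j ⟨x, hi, hj⟩) (P.h j k l ⟨x, ⟨hj, hk⟩, hl⟩) * P.h i j l ⟨x, ⟨hi, hj⟩, hl⟩ := by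
  have hx : x ∈ cechOpen O ![i, j, k, l] := fun m => by fin_cases m <;> assumption
  have h₀ : (P.τ 2 ![i, j, k, l] ⟨x, hx⟩).vertex 0 = P.d i j ⟨x, hi, hj⟩ :=
    P.vertex_τ_zero 2 _ x hx
  set g := P.τ 2 ![i, j, k, l] ⟨x, hx⟩
  -- the relations for the faces, compared on the arrow from the object `1` to the object `0`
  have h₁ : g.arrow 0 1 = P.h i j k ⟨x, ⟨hi, hj⟩, hk⟩ := by
    have f := congrArg (fun g => Nerve.arrow g 0 1) (P.face_succ 1 _ ⟨x, hx⟩ 1)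
    simp only [Nerve.face, Nerve.arrow_map] at f
    exact f.trans (P.h_eq _).symm
  have h₂ : g.arrow 0 2 = P.h i j l ⟨x, ⟨hi, hj⟩, hl⟩ := by
    have f := congrArg (fun g => Nerve.arrow g 0 1) (P.face_succ 1 _ ⟨x, hx⟩ 0)
    simp only [Nerve.face, Nerve.arrow_map] at f
    exact f.trans (P.h_eq _).symm
  have h₃ : g.arrow 1 2 * 𝒳.act (g.vertex 2) (P.h j k l ⟨x, ⟨hj, hk⟩, hl⟩) =
      P.h i k l ⟨x, ⟨hi, hk⟩, hl⟩ := by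
    have f := congrArg (fun g => Nerve.arrow g 0 1)
      (eq_mul_inv_iff_mul_eq.1 (P.face_zero 1 _ ⟨x, hx⟩))
    simp only [Nerve.face, Nerve.arrow_mul, Nerve.vertex_map, Nerve.arrow_map] at f
    have e₁ := P.h_eq (a := ![i, j, k, l] ∘ Fin.succAbove 0) (x := x) fun m => hx _
    have e₂ := P.h_eq (a := ![i, j, k, l] ∘ Fin.succAbove 1) (x := x) fun m => hx _
    exact (congrArg (fun y => g.arrow 1 2 * 𝒳.act (g.vertex 2) y) e₁).trans (f.trans e₂.symm)
  rw [← h₀, ← h₁, ← h₂, ← h₃, ← mul_assoc, Nerve.arrow_comp, ← Nerve.arrow_target g 0 2, map_mul,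
    MulAut.mul_apply, 𝒳.peiffer, inv_mul_cancel_right]

theorem isGerbeCocycle : IsGerbeCocycle (EX := EX) 𝒳 O P.d P.h where
  smooth_d := P.contMDiff_d
  smooth_h := P.contMDiff_h
  d_mul_d _ _ _ _ hi hj hk := P.d_mul_d hi hj hk
  h_mul_h _ _ _ _ _ hi hj hk hl := P.h_mul_h hi hj hk hl

end SimplicialBundle

end Bundle

/-! ### Pointwise operations on differential forms -/

namespace TwoForm

variable {EX : Type*} [NormedAddCommGroup EX] [NormedSpace ℝ EX]
  {X : Type*} [TopologicalSpace X] [ChartedSpace EX X] {U U' : Opens X}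
  {V W : Type*} [NormedAddCommGroup V] [NormedSpace ℝ V] [NormedAddCommGroup W] [NormedSpace ℝ W]

/-- The value of a form at a point, with tangent vectors regarded as elements of the model space. -/
def eval (w : TwoForm (EX := EX) U V) (x : X) (hx : x ∈ U) (v : Fin 2 → EX) : V := w ⟨x, hx⟩ v

theorem ext_eval {w w' : TwoForm (EX := EX) U V} (h : ∀ x hx v, w.eval x hx v = w'.eval x hx v) :
    w = w' := by
  have e : w.toFun = w'.toFun := funext fun x => ContinuousAlternatingMap.ext fun v => h x.1 x.2 v
  cases w; cases w'; cases e; rfl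

/-- A smooth function on an open set, extended by arbitrary values `F`, is smooth in charts. -/
theorem contDiffOn_comp_chart_symm [IsManifold 𝓘(ℝ, EX) ∞ X] {f : U → V}
    (hf : ContMDiff 𝓘(ℝ, EX) 𝓘(ℝ, V) ∞ f) {F : X → V} (hF : ∀ x : U, F x = f x) (x₀ : X) :
    ContDiffOn ℝ ∞ (fun y => F ((chartAt EX x₀).symm y))
      {y | y ∈ (chartAt EX x₀).target ∧ (chartAt EX x₀).symm y ∈ U} := by
  rw [← contMDiffOn_iff_contDiffOn]
  have hF' : ContMDiffOn 𝓘(ℝ, EX) 𝓘(ℝ, V) ∞ F U := fun x hx => by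
    have h : ContMDiffAt 𝓘(ℝ, EX) 𝓘(ℝ, V) ∞ (fun x : U => F x) ⟨x, hx⟩ := by
      simpa only [hF] using hf ⟨x, hx⟩
    exact (contMDiffAt_subtype_iff.1 h).contMDiffWithinAt
  exact hF'.comp ((contMDiffOn_chart_symm (I := 𝓘(ℝ, EX)) (x := x₀)).mono fun y hy => hy.1)
    fun y hy => hy.2

/-- The form on `U ⊆ U'` obtained from a form on `U'` by applying a smooth family of linear maps. -/
def applyLin [IsManifold 𝓘(ℝ, EX) ∞ X] (hU : U ≤ U') (L : U → V →L[ℝ] W)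
    (hL : ContMDiff 𝓘(ℝ, EX) 𝓘(ℝ, V →L[ℝ] W) ∞ L) (w : TwoForm (EX := EX) U' V) :
    TwoForm (EX := EX) U W where
  toFun x := (L x).compContinuousAlternatingMap (w ⟨x, hU x.2⟩)
  smooth x₀ := by
    classical
    set F : X → V →L[ℝ] W := fun x => if h : x ∈ U then L ⟨x, h⟩ else 0 with hF
    have h₁ := contDiffOn_comp_chart_symm hL (F := F) (fun x => by simp [hF]) x₀
    have h₂ := (w.smooth x₀).mono (t := {y | y ∈ (chartAt EX x₀).target ∧
      (chartAt EX x₀).symm y ∈ U}) fun y hy => ⟨hy.1, hU hy.2⟩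
    refine (((ContinuousLinearMap.compContinuousAlternatingMapCLM ℝ EX V W
      (Fin 2)).contDiff.comp_contDiffOn h₁).clm_apply h₂).congr fun y hy => ?_
    simp only [coordForm, Function.comp_apply, hF, dif_pos hy.2, dif_pos (hU hy.2)]
    rfl

/-- The pointwise sum of finitely many forms. -/
def sum {κ : Type*} [Fintype κ] (w : κ → TwoForm (EX := EX) U V) : TwoForm (EX := EX) U V where
  toFun x := ∑ k, w k x
  smooth x₀ := by
    refine (ContDiffOn.sum (s := Finset.univ) fun k _ => (w k).smooth x₀).congr fun y hy => ?_
    simp only [coordForm, dif_pos hy.2]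
    refine ContinuousAlternatingMap.ext fun v => ?_
    rw [ContinuousAlternatingMap.sum_apply]
    exact ContinuousAlternatingMap.sum_apply _ _

theorem eval_sum {κ : Type*} [Fintype κ] (w : κ → TwoForm (EX := EX) U V) (x : X) (hx : x ∈ U)
    (v : Fin 2 → EX) : (sum w).eval x hx v = ∑ k, (w k).eval x hx v :=
  ContinuousAlternatingMap.sum_apply _ _

end TwoForm

section Fields

variable {EH : Type*} [NormedAddCommGroup EH] [NormedSpace ℝ EH]
  {ED : Type*} [NormedAddCommGroup ED] [NormedSpace ℝ ED]
  {EX : Type*} [NormedAddCommGroup EX] [NormedSpace ℝ EX]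
  {H : Type*} [TopologicalSpace H] [ChartedSpace EH H] [Group H]
  {D : Type*} [TopologicalSpace D] [ChartedSpace ED D] [Group D]
  {X : Type*} [TopologicalSpace X] [ChartedSpace EX X] {ι : Type*}
  {𝒳 : CrossedModule (EH := EH) (ED := ED) H D} {O : ι → Opens X}

/-! ### Simplicial fields in components -/

namespace BBarField

variable {P : SimplicialBundle (EX := EX) 𝒳 O} (F : BBarField P)

theorem ext_eval {F F' : BBarField P}
    (h : ∀ n a x hx v, (F.form n a).eval x hx v = (F'.form n a).eval x hx v) : F = F' := by
  have e : F.form = F'.form := funext fun n => funext fun a => TwoForm.ext_eval (h n a)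
  cases F; cases F'; cases e; rfl

theorem eval_congr {n : ℕ} {a a' : Fin (n + 1) → ι} (ha : a = a') {x : X} (hx : x ∈ cechOpen O a)
    (hx' : x ∈ cechOpen O a') (v : Fin 2 → EX) :
    (F.form n a).eval x hx v = (F.form n a').eval x hx' v := by
  subst ha; rfl

theorem lieVertex_eval [LieGroup 𝓘(ℝ, ED) ∞ D] (n : ℕ) (a : Fin (n + 1) → ι) (x : X)
    (hx : x ∈ cechOpen O a) (v : Fin 2 → EX) : Nerve.lieVertex 𝒳 (n + 1) ((F.form n a).eval x hx v) = 0 :=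
  (Nerve.mem_lieBar_iff _).1 (F.mem_lieBar n a ⟨x, hx⟩ v)

variable [LieGroup 𝓘(ℝ, EH) ∞ H] [LieGroup 𝓘(ℝ, ED) ∞ D]

/-- The arrows `d_{k+1} → d_0` of a simplicial field are determined by its values on the vertices of
the Čech nerve: discarding the last vertex leaves the arrow `d_1 → d_0` unchanged, and the
condition involving `τ` relates the arrow `d_{k+2} → d_0` to the arrow `d_{k+1} → d_0` on the simplex
without its first vertex. -/
theorem lieArrowZero_eval (n : ℕ) : ∀ (a : Fin (n + 1) → ι) (x : X) (hx : x ∈ cechOpen O a)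
    (v : Fin 2 → EX) (k : Fin (n + 1)),
    Nerve.lieArrowZero 𝒳 k.succ ((F.form n a).eval x hx v) =
      𝒳.lieAct (P.d (a 0) (a k) ⟨x, mem_inf_of_cechOpen hx 0 k⟩)
        (Nerve.lieArrow ((F.form 0 ![a k]).eval x (mem_cechOpen_single (mem_of_cechOpen hx k)) v)) := by
  induction n with
  | zero =>
    intro a x hx v k
    obtain rfl : k = 0 := Fin.fin_one_eq_zero k
    rw [P.d_self, 𝒳.lieAct_one]
    exact congrArg (Nerve.lieArrow (𝒳 := 𝒳))
      (F.eval_congr (by ext k; rw [Fin.fin_one_eq_zero k]; rfl) hx _ v)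
  | succ n ih =>
    intro a x hx v k
    refine Fin.cases ?_ (fun k => ?_) k
    · have h : (F.form n (a ∘ (Fin.last (n + 1)).succAbove)).eval x (mem_cechOpen_comp hx _) v =
          Nerve.lieMap (Nerve.face (Fin.last (n + 1)).succ) ((F.form (n + 1) a).eval x hx v) :=
        DFunLike.congr_fun (F.face_succ n a ⟨x, hx⟩ (Fin.last (n + 1)) (Fin.last_pos)) v
      have h' := congrArg (Nerve.lieArrowZero 𝒳 (Fin.succ 0)) h
      rw [Nerve.face, Nerve.lieArrowZero_map rfl, ih] at h'
      exact h'.symm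
    · have h : Nerve.lieMap (Nerve.barAct (P.τ n a ⟨x, hx⟩))
          ((F.form n (a ∘ Fin.succAbove 0)).eval x (mem_cechOpen_comp hx _) v) =
          Nerve.lieMap (Nerve.face 1) ((F.form (n + 1) a).eval x hx v) :=
        DFunLike.congr_fun (F.face_zero n a ⟨x, hx⟩) v
      have h' := congrArg (Nerve.lieArrowZero 𝒳 k.succ) h
      have e : Fin.succAbove (1 : Fin (n + 3)) k.succ = k.succ.succ :=
        Fin.succAbove_of_le_castSucc _ _ (by simp [Fin.le_def])
      rw [Nerve.lieArrowZero_barAct _ (F.lieVertex_eval _ _ _ _ _), ih, ← 𝒳.lieAct_mul, Nerve.face,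
        Nerve.lieArrowZero_map rfl, e] at h'
      rw [← h', ← P.vertex_τ_mul_d n a x hx k]
      rfl

end BBarField

/-! ### From simplicial fields to fields on the gerbe -/

theorem GerbeBField.ext_eval {d : ∀ i j, (O i ⊓ O j : Opens X) → D}
    {h : ∀ i j k, (O i ⊓ O j ⊓ O k : Opens X) → H} {b b' : GerbeBField (EX := EX) 𝒳 O d h}
    (hB : ∀ i x hx v, (b.B i).eval x hx v = (b'.B i).eval x hx v)
    (hδ : ∀ i j x hx v, (b.δ i j).eval x hx v = (b'.δ i j).eval x hx v) : b = b' := by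
  have e : b.B = b'.B := funext fun i => TwoForm.ext_eval (hB i)
  have e' : b.δ = b'.δ := funext fun i => funext fun j => TwoForm.ext_eval (hδ i j)
  cases b; cases b'; cases e; cases e'; rfl

/-- The first equation of a field on the gerbe, evaluated on tangent vectors. -/
theorem GerbeBField.δ_eval {d : ∀ i j, (O i ⊓ O j : Opens X) → D}
    {h : ∀ i j k, (O i ⊓ O j ⊓ O k : Opens X) → H} (b : GerbeBField (EX := EX) 𝒳 O d h) {i j : ι}
    {x : X} (hi : x ∈ O i) (hj : x ∈ O j) (v : Fin 2 → EX) :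
    (b.δ i j).eval x ⟨hi, hj⟩ v =
      (b.B i).eval x hi v - 𝒳.lieAct (d i j ⟨x, hi, hj⟩) ((b.B j).eval x hj v) :=
  eq_sub_of_add_eq' (DFunLike.congr_fun (b.B_eq i j x hi hj) v).symm

variable {P : SimplicialBundle (EX := EX) 𝒳 O}
  [LieGroup 𝓘(ℝ, EH) ∞ H] [LieGroup 𝓘(ℝ, ED) ∞ D]

/-- The form `∂_2 B̄_2 - ∂_1 B̄_2` is `B_i - ᵈB_j` with `d = d_ij`, where `B` is minus the arrow of
`B̄_1`. -/
theorem BBarField.lieArrow_face_sub_face (F : BBarField P) {i j : ι} {x : X} (hi : x ∈ O i)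
    (hj : x ∈ O j) (v : Fin 2 → EX) :
    ((-Nerve.lieArrow (𝒳 := 𝒳)).comp (Nerve.lieMap (Nerve.face 2) - Nerve.lieMap (Nerve.face 1)))
        ((F.form 1 ![i, j]).eval x (mem_cechOpen_pair hi hj) v) =
      (-Nerve.lieArrow (𝒳 := 𝒳)) ((F.form 0 ![i]).eval x (mem_cechOpen_single hi) v) -
        𝒳.lieAct (P.d i j ⟨x, hi, hj⟩)
          ((-Nerve.lieArrow (𝒳 := 𝒳)) ((F.form 0 ![j]).eval x (mem_cechOpen_single hj) v)) := by
  have h₀ := F.lieArrowZero_eval 1 ![i, j] x (mem_cechOpen_pair hi hj) v 0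
  have h₁ := F.lieArrowZero_eval 1 ![i, j] x (mem_cechOpen_pair hi hj) v 1
  set Y := (F.form 1 ![i, j]).eval x (mem_cechOpen_pair hi hj) v
  have e₂ : Nerve.lieArrow (Nerve.lieMap (Nerve.face 2) Y) = Nerve.lieArrowZero 𝒳 1 Y :=
    Nerve.lieArrowZero_map (f := Fin.succAbove 2) rfl 1 Y
  have e₁ : Nerve.lieArrow (Nerve.lieMap (Nerve.face 1) Y) = Nerve.lieArrowZero 𝒳 2 Y :=
    Nerve.lieArrowZero_map (f := Fin.succAbove 1) rfl 1 Y
  have e₂' := e₂.trans (h₀.trans (congrArg (fun d => 𝒳.lieAct d _) (P.d_self _)))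
  rw [𝒳.lieAct_one] at e₂'
  simp only [ContinuousLinearMap.comp_apply, neg_apply, sub_apply, map_sub, map_neg,
    e₁.trans h₁, e₂', sub_neg_eq_add]
  rfl

/-- A simplicial field is determined by the corresponding field on the gerbe. -/
theorem Corresponds.unique {F F' : BBarField P} {b : GerbeBField (EX := EX) 𝒳 O P.d P.h}
    (h : Corresponds F b) (h' : Corresponds F' b) : F = F' := by
  refine BBarField.ext_eval fun n a x hx v => Nerve.lie_ext ?_ fun j => ?_
  · rw [F.lieVertex_eval, F'.lieVertex_eval]
  · refine Fin.cases ?_ (fun k => ?_) j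
    · rw [Nerve.lieArrowZero_zero, Nerve.lieArrowZero_zero]
    · rw [F.lieArrowZero_eval, F'.lieArrowZero_eval]
      have e := DFunLike.congr_fun ((h.B_eq _ x (hx k)).symm.trans (h'.B_eq _ x (hx k))) v
      exact congrArg _ (neg_injective e)

variable [IsManifold 𝓘(ℝ, EX) ∞ X]

/-- The field on the gerbe corresponding to a simplicial field. -/
def BBarField.toGerbe (F : BBarField P) : GerbeBField (EX := EX) 𝒳 O P.d P.h where
  B i := (F.form 0 ![i]).applyLin (fun _ hx => mem_cechOpen_single hx)
    (fun _ => -Nerve.lieArrow (𝒳 := 𝒳)) contMDiff_const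
  δ i j := (F.form 1 ![i, j]).applyLin (fun _ hx => mem_cechOpen_pair hx.1 hx.2)
    (fun _ => (-Nerve.lieArrow (𝒳 := 𝒳)).comp
      (Nerve.lieMap (Nerve.face 2) - Nerve.lieMap (Nerve.face 1))) contMDiff_const
  B_eq i j x hi hj := by
    refine ContinuousAlternatingMap.ext fun v => ?_
    exact (add_eq_of_eq_sub' (F.lieArrow_face_sub_face hi hj v)).symm
  δ_eq i j k x hi hj hk := by
    refine ContinuousAlternatingMap.ext fun v => ?_
    have hij := F.lieArrow_face_sub_face hi hj v
    have hjk := F.lieArrow_face_sub_face hj hk v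
    have hik := F.lieArrow_face_sub_face hi hk v
    have hd : ∀ Y, 𝒳.lieAct (P.d i j ⟨x, hi, hj⟩) (𝒳.lieAct (P.d j k ⟨x, hj, hk⟩) Y) =
        lieConj (P.h i j k ⟨x, ⟨hi, hj⟩, hk⟩) (𝒳.lieAct (P.d i k ⟨x, hi, hk⟩) Y) := fun Y => by
      rw [← 𝒳.lieAct_mul, P.d_mul_d hi hj hk, 𝒳.lieAct_mul, 𝒳.lieAct_α]
    refine (congrArg₂ (fun Y Z => Y + 𝒳.lieAct (P.d i j ⟨x, hi, hj⟩) Z) hij hjk).trans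
      (Eq.trans ?_ (congrArg (fun Y => lieConj (P.h i j k ⟨x, ⟨hi, hj⟩, hk⟩) Y +
        (-Nerve.lieArrow (𝒳 := 𝒳)) ((F.form 0 ![i]).eval x (mem_cechOpen_single hi) v) -
        lieConj (P.h i j k ⟨x, ⟨hi, hj⟩, hk⟩) ((-Nerve.lieArrow (𝒳 := 𝒳))
          ((F.form 0 ![i]).eval x (mem_cechOpen_single hi) v))) hik).symm)
    simp only [map_sub, hd]
    abel

theorem BBarField.corresponds_toGerbe (F : BBarField P) : Corresponds F F.toGerbe where
  B_eq _ _ _ := rfl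
  δ_eq _ _ _ _ _ := rfl

/-! ### From fields on the gerbe to simplicial fields -/

/-- The forms of the simplicial field corresponding to a field `B` on the gerbe: on
`O_{a_0} ∩ ⋯ ∩ O_{a_n}`, the component along the arrow `d_{k+1} → d_0` is minus `B_{a_k}`,
transported by `d_{a_0 a_k}`. -/
def GerbeBField.barForm (b : GerbeBField (EX := EX) 𝒳 O P.d P.h) (n : ℕ) (a : Fin (n + 1) → ι) :
    TwoForm (EX := EX) (cechOpen O a) (LieNerve 𝒳 (n + 1)) :=
  TwoForm.sum fun k => (b.B (a k)).applyLin (fun _ hx => mem_of_cechOpen hx k)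
    (fun x => (-Nerve.lieSingle 𝒳 k).comp
      (𝒳.lieAct (P.d (a 0) (a k) ⟨x, mem_inf_of_cechOpen x.2 0 k⟩)))
    ((ContinuousLinearMap.compL ℝ EH EH (LieNerve 𝒳 (n + 1))
      (-Nerve.lieSingle 𝒳 k)).contMDiff.comp (𝒳.contMDiff_lieAct.comp
        ((P.contMDiff_d (a 0) (a k)).comp (contMDiff_inclusion
          (fun _ hx => mem_inf_of_cechOpen hx 0 k : cechOpen O a ≤ O (a 0) ⊓ O (a k))))))

theorem GerbeBField.eval_barForm (b : GerbeBField (EX := EX) 𝒳 O P.d P.h) (n : ℕ)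
    (a : Fin (n + 1) → ι) (x : X) (hx : x ∈ cechOpen O a) (v : Fin 2 → EX) :
    (b.barForm n a).eval x hx v = ∑ k, -Nerve.lieSingle 𝒳 k
      (𝒳.lieAct (P.d (a 0) (a k) ⟨x, mem_inf_of_cechOpen hx 0 k⟩)
        ((b.B (a k)).eval x (mem_of_cechOpen hx k) v)) :=
  TwoForm.eval_sum _ _ _ _

theorem GerbeBField.lieVertex_barForm (b : GerbeBField (EX := EX) 𝒳 O P.d P.h) (n : ℕ)
    (a : Fin (n + 1) → ι) (x : X) (hx : x ∈ cechOpen O a) (v : Fin 2 → EX) :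
    Nerve.lieVertex 𝒳 (n + 1) ((b.barForm n a).eval x hx v) = 0 := by
  simp [eval_barForm, Nerve.lieVertex_lieSingle]

theorem GerbeBField.lieArrowZero_barForm (b : GerbeBField (EX := EX) 𝒳 O P.d P.h) (n : ℕ)
    (a : Fin (n + 1) → ι) (x : X) (hx : x ∈ cechOpen O a) (v : Fin 2 → EX) (k : Fin (n + 1)) :
    Nerve.lieArrowZero 𝒳 k.succ ((b.barForm n a).eval x hx v) =
      -𝒳.lieAct (P.d (a 0) (a k) ⟨x, mem_inf_of_cechOpen hx 0 k⟩)
        ((b.B (a k)).eval x (mem_of_cechOpen hx k) v) := by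
  simp [eval_barForm, Nerve.lieArrowZero_lieSingle]

/-- If the simplicial operators `f'` on `Ḡ` and `f` on the Čech nerve fix `0` and correspond under
the shift of indices by one, then `f'` carries the forms `barForm` to their pullbacks along `f`. -/
theorem GerbeBField.barForm_comp (b : GerbeBField (EX := EX) 𝒳 O P.d P.h) {m n : ℕ}
    {f : Fin (m + 1) → Fin (n + 1)} {f' : Fin (m + 2) → Fin (n + 2)} (h₀ : f 0 = 0) (h₀' : f' 0 = 0)
    (hf : ∀ k : Fin (m + 1), f' k.succ = (f k).succ) (a : Fin (n + 1) → ι) (x : X)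
    (hx : x ∈ cechOpen O a) (v : Fin 2 → EX) :
    (b.barForm m (a ∘ f)).eval x (mem_cechOpen_comp hx f) v =
      Nerve.lieMap (Nerve.map f') ((b.barForm n a).eval x hx v) := by
  refine Nerve.lie_ext ?_ fun j => ?_
  · rw [Nerve.lieVertex_map h₀', lieVertex_barForm, lieVertex_barForm]
  · rw [Nerve.lieArrowZero_map h₀']
    refine Fin.cases ?_ (fun k => ?_) j
    · rw [h₀', Nerve.lieArrowZero_zero, Nerve.lieArrowZero_zero]
    · rw [hf, lieArrowZero_barForm, lieArrowZero_barForm]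
      exact congrArg (fun d => -𝒳.lieAct d _) (P.d_congr (congrArg a h₀) rfl _ _)

/-- The simplicial field corresponding to a field on the gerbe. -/
def GerbeBField.toBBar (b : GerbeBField (EX := EX) 𝒳 O P.d P.h) : BBarField P where
  form := b.barForm
  mem_lieBar n a x v := (Nerve.mem_lieBar_iff _).2 (b.lieVertex_barForm n a x.1 x.2 v)
  face_zero n a x := by
    refine ContinuousAlternatingMap.ext fun (v : Fin 2 → EX) => ?_
    change Nerve.lieMap (Nerve.barAct (P.τ n a x))
        ((b.barForm n (a ∘ Fin.succAbove 0)).eval x (mem_cechOpen_comp x.2 _) v) =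
      Nerve.lieMap (Nerve.face 1) ((b.barForm (n + 1) a).eval x x.2 v)
    have hV := b.lieVertex_barForm n (a ∘ Fin.succAbove 0) x (mem_cechOpen_comp x.2 _) v
    refine Nerve.lie_ext ?_ fun j => ?_
    · rw [Nerve.lieVertex_barAct _ hV, Nerve.face, Nerve.lieVertex_map rfl, lieVertex_barForm]
    · rw [Nerve.face, Nerve.lieArrowZero_map rfl]
      refine Fin.cases ?_ (fun k => ?_) j
      · exact (Nerve.lieArrowZero_zero _).trans (Nerve.lieArrowZero_zero _).symm
      · have e : Fin.succAbove (1 : Fin (n + 3)) k.succ = k.succ.succ :=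
          Fin.succAbove_of_le_castSucc _ _ (by simp [Fin.le_def])
        rw [Nerve.lieArrowZero_barAct _ hV, e, lieArrowZero_barForm, lieArrowZero_barForm, map_neg,
          ← 𝒳.lieAct_mul, ← P.vertex_τ_mul_d n a x x.2 k]
        rfl
  face_succ n a x i hi := ContinuousAlternatingMap.ext fun v =>
    b.barForm_comp (Fin.succAbove_ne_zero_zero hi.ne')
      (Fin.succAbove_ne_zero_zero (Fin.succ_ne_zero i))
      (fun k => Fin.succ_succAbove_succ i k) a x.1 x.2 v
  degen n a x i := ContinuousAlternatingMap.ext fun v =>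
    b.barForm_comp (f := i.predAbove) (f' := i.succ.predAbove) (by simp) (by simp)
      (fun k => Fin.succ_predAbove_succ i k) a x.1 x.2 v

theorem GerbeBField.corresponds_toBBar (b : GerbeBField (EX := EX) 𝒳 O P.d P.h) :
    Corresponds b.toBBar b := by
  have hB : ∀ (i : ι) (x : X) (hi : x ∈ O i) (v : Fin 2 → EX), (b.B i).eval x hi v =
      (-Nerve.lieArrow (𝒳 := 𝒳)) ((b.toBBar.form 0 ![i]).eval x (mem_cechOpen_single hi) v) := by
    intro i x hi v
    have h := b.lieArrowZero_barForm 0 ![i] x (mem_cechOpen_single hi) v 0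
    have h' := h.trans (congrArg (fun d => -𝒳.lieAct d _) (P.d_self _))
    rw [𝒳.lieAct_one] at h'
    rw [neg_apply]
    exact (neg_eq_iff_eq_neg.2 h').symm
  refine ⟨fun i x hi => ContinuousAlternatingMap.ext fun v => hB i x hi v,
    fun i j x hi hj => ContinuousAlternatingMap.ext fun v => ?_⟩
  exact (b.δ_eval hi hj v).trans ((congrArg₂ (fun Y Z => Y - 𝒳.lieAct (P.d i j ⟨x, hi, hj⟩) Z)
    (hB i x hi v) (hB j x hj v)).trans (b.toBBar.lieArrow_face_sub_face hi hj v).symm)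

end Fields

end CrossedGerbe

end

theorem proposition6p4
    {EH : Type*} [NormedAddCommGroup EH] [NormedSpace ℝ EH]
    {ED : Type*} [NormedAddCommGroup ED] [NormedSpace ℝ ED]
    {EX : Type*} [NormedAddCommGroup EX] [NormedSpace ℝ EX]
    {H : Type*} [TopologicalSpace H] [ChartedSpace EH H] [Group H] [LieGroup 𝓘(ℝ, EH) ∞ H]
    {D : Type*} [TopologicalSpace D] [ChartedSpace ED D] [Group D] [LieGroup 𝓘(ℝ, ED) ∞ D]
    {X : Type*} [TopologicalSpace X] [ChartedSpace EX X] [IsManifold 𝓘(ℝ, EX) ∞ X]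
    {ι : Type*} (𝒳 : CrossedGerbe.CrossedModule (EH := EH) (ED := ED) H D)
    (O : ι → TopologicalSpace.Opens X) (_hO : ⨆ i, O i = ⊤)
    (P : CrossedGerbe.SimplicialBundle (EX := EX) 𝒳 O) :
    CrossedGerbe.IsGerbeCocycle (EX := EX) 𝒳 O P.d P.h ∧
      (∀ Bbar : CrossedGerbe.BBarField P,
        ∃! b : CrossedGerbe.GerbeBField (EX := EX) 𝒳 O P.d P.h, CrossedGerbe.Corresponds Bbar b) ∧
      (∀ b : CrossedGerbe.GerbeBField (EX := EX) 𝒳 O P.d P.h,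
        ∃! Bbar : CrossedGerbe.BBarField P, CrossedGerbe.Corresponds Bbar b) := by
  refine ⟨P.isGerbeCocycle, fun Bbar => ⟨Bbar.toGerbe, Bbar.corresponds_toGerbe, fun b hb => ?_⟩,
    fun b => ⟨b.toBBar, b.corresponds_toBBar, fun F hF => hF.unique b.corresponds_toBBar⟩⟩
  exact CrossedGerbe.GerbeBField.ext_eval
    (fun i x hx v => DFunLike.congr_fun (hb.B_eq i x hx) v)
    (fun i j x hx v => DFunLike.congr_fun (hb.δ_eq i j x hx.1 hx.2) v)
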